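/- Fix $r\in(0,\infty)$ and put $v=(1+r^{-1})^{-1}$. For $\theta\in\mathbb{R}^n$ let $X\sim N_n(\theta,I)$ and $Y\sim N_n(\theta,rI)$ be independent, and write $p(x\mid\theta,w)$ for the density of $N_n(\theta,wI)$. A predictive density estimator $\hat p$ is a measurable function $(x,y)\mapsto\hat p(y\mid x)$ which is a probability density in $y\in\mathbb{R}^n$ for each $x\in\mathbb{R}^n$. Its Kullback–Leibler risk is $$\rho(\theta,\hat p)=\int\Big(\int p(y\mid\theta,r)\log\frac{p(y\mid\theta,r)}{\hat p(y\mid x)}\,dy\Big)\,p(x\mid\theta,1)\,dx\in[0,\infty],$$ and the minimax risk over $\Theta\subseteq\mathbb{R}^n$ is $R_N(\Theta)=\inf_{\hat p}\sup_{\theta\in\Theta}\rho(\theta,\hat p)$, the infimum being over all predictive density estimators. With $\|\theta\|_0=\#\{i:\theta_i\neq0\}$, let $$\Theta_n[s]=\{\theta\in\mathbb{R}^n:\|\theta\|_0\le s\},\qquad \Theta_n[s,t]=\{\theta\in\Theta_n[s]:|\theta_i|\le t\text{ for all }i\}.$$ For positive sequences, $a_n\sim b_n$ means $a_n/b_n\to1$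 as $n\to\infty$. **Lemma 1.2.** (a) For all integers $n,s_n\ge0$ and all real $t_n$ (with the convention $\sup_{\theta\in\emptyset}\rho=0$), $$R_N(\Theta_n[s_n,t_n])\le \frac{s_nt_n^2}{2r}.$$ (b) Let $(s_n)$ be a sequence of non-negative integers with $s_n\ge1$ for all large $n$ and $\eta_n=s_n/n\to0$, put $\lambda_n=\sqrt{2\log\eta_n^{-v}}$, and let $(t_n)$ be real numbers with $t_n>\lambda_n$ for all large $n$. Then, as $n\to\infty$, $$R_N(\Theta_n[s_n,t_n])\sim\frac{s_n\lambda_n^2}{2r}\sim R_N(\Theta_n[s_n]).$$ -/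

import Mathlib

open MeasureTheory ProbabilityTheory InformationTheory Filter Topology
open scoped NNReal ENNReal

namespace SparsePrediction

/-- The normal distribution `N_n(θ, w I)` on `ℝⁿ`: independent coordinates, the `i`-th one
being `N(θ_i, w)`. -/
noncomputable def normalLaw {n : ℕ} (θ : Fin n → ℝ) (w : ℝ≥0) : Measure (Fin n → ℝ) :=
  Measure.pi fun i => gaussianReal (θ i) w

/-- A predictive density estimator `p̂(y | x)` on `ℝⁿ`: an arbitrary jointly measurable function
of the past observation `x` and the future value `y` which is, for every `x`, a probability
density in `y` with respect to Lebesgue measure. -/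
structure PredictiveDensity (n : ℕ) where
  /-- The value `p̂(y | x)`, with the arguments in the order `x`, `y`. -/
  density : (Fin n → ℝ) → (Fin n → ℝ) → ℝ≥0∞
  measurable_density : Measurable (Function.uncurry density)
  lintegral_density : ∀ x, ∫⁻ y, density x y = 1

/-- The Kullback-Leibler loss `L(θ, p̂(·|x)) = ∫ p(y|θ,r) log (p(y|θ,r) / p̂(y|x)) dy ∈ [0, ∞]`,
that is, the Kullback-Leibler divergence of the estimated law of the future observation
from its true law `N_n(θ, r I)`. -/
noncomputable def klLoss {n : ℕ} (r : ℝ≥0) (θ : Fin n → ℝ) (p : PredictiveDensity n)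
    (x : Fin n → ℝ) : ℝ≥0∞ :=
  klDiv (normalLaw θ r) (volume.withDensity (p.density x))

/-- The Kullback-Leibler risk `ρ(θ, p̂) = ∫ L(θ, p̂(·|x)) p(x|θ,1) dx`, the past observation
being `N_n(θ, I)`. -/
noncomputable def klRisk {n : ℕ} (r : ℝ≥0) (θ : Fin n → ℝ) (p : PredictiveDensity n) : ℝ≥0∞ :=
  ∫⁻ x, klLoss r θ p x ∂(normalLaw θ 1)

/-- The minimax risk `R_N(Θ) = inf_p̂ sup_{θ ∈ Θ} ρ(θ, p̂)`, the infimum being over all predictive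
density estimators. -/
noncomputable def minimaxRisk {n : ℕ} (r : ℝ≥0) (Θ : Set (Fin n → ℝ)) : ℝ≥0∞ :=
  ⨅ p : PredictiveDensity n, ⨆ θ ∈ Θ, klRisk r θ p

/-- `Θ_n[s]`: the vectors in `ℝⁿ` with at most `s` nonzero coordinates
(`hammingNorm θ` is the number of nonzero coordinates). -/
def sparseSet (n s : ℕ) : Set (Fin n → ℝ) :=
  {θ | hammingNorm θ ≤ s}

/-- `Θ_n[s, t]`: the vectors in `Θ_n[s]` all of whose coordinates satisfy `|θ_i| ≤ t`. -/
def boundedSparseSet (n s : ℕ) (t : ℝ) : Set (Fin n → ℝ) :=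
  {θ | hammingNorm θ ≤ s ∧ ∀ i, |θ i| ≤ t}

/-- The oracle variance `v = (1 + r⁻¹)⁻¹`. -/
noncomputable def oracleVar (r : ℝ≥0) : ℝ :=
  (1 + (r : ℝ)⁻¹)⁻¹

/-- `λ(η) = √(2 log η^{-v})`. -/
noncomputable def lam (r : ℝ≥0) (η : ℝ) : ℝ :=
  Real.sqrt (2 * Real.log (η ^ (-oracleVar r)))

/-- `a_n ∼ b_n`, that is `a_n / b_n → 1`, for sequences in `[0, ∞]`. As `0 / 0 = 0`, `∞ / ∞ = 0`
and `a / 0 = ∞` for `a ≠ 0`, it entails that both are eventually finite and nonzero. -/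
def AsympEquiv (a b : ℕ → ℝ≥0∞) : Prop :=
  Tendsto (fun n => a n / b n) atTop (𝓝 1)

end SparsePrediction

namespace SparsePrediction

/-! Write `L = log (n / s)`, so that `λ² / 2 = v L` and the target `s λ² / (2 r)` equals `s L / (1 +
r)`. Part (a) is the risk `∑ θ_i² / (2 r)` of always predicting `N(0, r I)`. For part (b), both
minimax risks are squeezed within `O(s √L)` of the target, and `L → ∞`.

Upper bound: in each coordinate predict by the mixture of the spike `N(0, r)` and the slab `N(x, 1 +
r)` whose spike weight is `(1 + η e^{x²/2})⁻¹`, with `η = s / n = e^{-L}`. A mixture dominates each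
of its components, so its loss is at most the loss of either component plus minus the log of that
component's weight. A zero coordinate is compared with the spike and costs `O(η √L)`, hence `O(s
√L)` over all `n` coordinates. A nonzero coordinate is compared with the spike if `θ² / 2 ≤ v L` and
with the slab otherwise; either way it costs at most `L / (1 + r) + O(√L)`.

Lower bound: split `s ⌊n / s⌋` coordinates into `s` blocks of size `m = ⌊n / s⌋` and put one spike
`τ` at a uniformly chosen place of each block, where `τ² / 2 * (1 + 1 / r) = log m`. At this height
the likelihood ratio of `(X, Y)` under the prior against pure noise has log-expectation `O(s τ)`, so
the spikes are nearly invisible even from `X` and `Y` together. No estimator then does much better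
than `N(0, r I)`, whose risk is `s τ² / (2 r) = s log m / (1 + r)`. `ofReal_le_minimaxRisk_add`
makes this precise by a linearised Donsker-Varadhan inequality averaged over the prior. -/

/-! ### Product measures -/

/-- Tonelli's theorem for a product of functions of the single coordinates. -/
theorem lintegral_fin_prod {n : ℕ} {μ : Fin n → Measure ℝ} [∀ i, SigmaFinite (μ i)]
    {f : Fin n → ℝ → ℝ≥0∞} (hf : ∀ i, Measurable (f i)) :
    ∫⁻ x, ∏ i, f i (x i) ∂(Measure.pi μ) = ∏ i, ∫⁻ x, f i x ∂(μ i) := by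
  induction n with
  | zero => simp
  | succ n ih =>
    rw [← ((measurePreserving_piFinSuccAbove μ 0).symm).lintegral_comp_emb
      (MeasurableEquiv.measurableEmbedding _)]
    simp_rw [MeasurableEquiv.piFinSuccAbove_symm_apply, Fin.insertNthEquiv,
      Fin.prod_univ_succ, Fin.insertNth_zero, Equiv.coe_fn_mk, Fin.cons_succ,
      Fin.zero_succAbove, cast_eq, Fin.cons_zero]
    rw [lintegral_prod_mul (f := f 0) (g := fun x : Fin n → ℝ => ∏ i : Fin n, f i.succ (x i))
      (hf 0).aemeasurable, ih (fun i => hf i.succ)]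
    exact (Finset.measurable_fun_prod _
      fun i _ => (hf i.succ).comp (measurable_pi_apply i)).aemeasurable

/-- A product of measures with densities has the product density. -/
theorem pi_withDensity {n : ℕ} {μ : Fin n → Measure ℝ} [∀ i, SigmaFinite (μ i)]
    {f : Fin n → ℝ → ℝ≥0∞} (hf : ∀ i, Measurable (f i))
    [∀ i, SigmaFinite ((μ i).withDensity (f i))] :
    Measure.pi (fun i => (μ i).withDensity (f i))
      = (Measure.pi μ).withDensity fun x => ∏ i, f i (x i) := by
  refine Measure.pi_eq fun s hs => ?_
  rw [withDensity_apply _ (MeasurableSet.univ_pi hs), Measure.restrict_pi_pi,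
    lintegral_fin_prod hf]
  exact Finset.prod_congr rfl fun i _ => (withDensity_apply _ (hs i)).symm

instance {n : ℕ} (θ : Fin n → ℝ) (w : ℝ≥0) : IsProbabilityMeasure (normalLaw θ w) := by
  unfold normalLaw; infer_instance

theorem normalLaw_eq_withDensity {n : ℕ} (θ : Fin n → ℝ) {w : ℝ≥0} (hw : w ≠ 0) :
    normalLaw θ w = volume.withDensity fun y => ∏ i, gaussianPDF (θ i) w (y i) := by
  have h (i : Fin n) : SigmaFinite (volume.withDensity (gaussianPDF (θ i) w)) := by
    rw [← gaussianReal_of_var_ne_zero _ hw]; infer_instance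
  rw [volume_pi, ← pi_withDensity fun i => measurable_gaussianPDF _ _]
  simp only [normalLaw, gaussianReal_of_var_ne_zero _ hw]

theorem lintegral_normalLaw_eval {n : ℕ} (θ : Fin n → ℝ) (w : ℝ≥0) (i : Fin n)
    {f : ℝ → ℝ≥0∞} (hf : Measurable f) :
    ∫⁻ x, f (x i) ∂(normalLaw θ w) = ∫⁻ x, f x ∂(gaussianReal (θ i) w) := by
  rw [← (measurePreserving_eval (fun i => gaussianReal (θ i) w) i).map_eq,
    lintegral_map hf (measurable_pi_apply i)]
  rfl

/-! ### Bounds on the Kullback-Leibler divergence -/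

section klDiv

variable {α : Type*} [MeasurableSpace α]

/-- If `log (dμ/dν) ≤ h`, then `KL(μ, ν) ≤ ∫ h dμ`. -/
theorem klDiv_withDensity_le {ν : Measure α} [IsProbabilityMeasure ν] {u h : α → ℝ}
    (hu : Measurable u) (hu0 : ∀ y, 0 ≤ u y)
    [IsProbabilityMeasure (ν.withDensity fun y => ENNReal.ofReal (u y))]
    (huh : ∀ y, Real.log (u y) ≤ h y)
    (hh : Integrable h (ν.withDensity fun y => ENNReal.ofReal (u y))) :
    klDiv (ν.withDensity fun y => ENNReal.ofReal (u y)) ν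
      ≤ ENNReal.ofReal (∫ y, h y ∂(ν.withDensity fun y => ENNReal.ofReal (u y))) := by
  set μ := ν.withDensity fun y => ENNReal.ofReal (u y) with hμ
  have hlt : ∀ᵐ y ∂ν, ENNReal.ofReal (u y) < ∞ := ae_of_all _ fun _ => ENNReal.ofReal_lt_top
  have hum : Measurable fun y => ENNReal.ofReal (u y) := hu.ennreal_ofReal
  have hint : Integrable (fun y => u y * h y) ν := by
    have := (integrable_withDensity_iff_integrable_smul' hum hlt).1 hh
    simpa [ENNReal.toReal_ofReal (hu0 _)] using this
  have hu1 : ∫⁻ y, ENNReal.ofReal (u y) ∂ν = 1 := by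
    have := measure_univ (μ := μ)
    rwa [hμ, withDensity_apply _ MeasurableSet.univ, Measure.restrict_univ] at this
  have huint : Integrable u ν := by
    rw [← lintegral_ofReal_ne_top_iff_integrable hu.aestronglyMeasurable (ae_of_all _ hu0), hu1]
    exact ENNReal.one_ne_top
  have huint1 : ∫ y, u y ∂ν = 1 := by
    rw [integral_eq_lintegral_of_nonneg_ae (ae_of_all _ hu0) hu.aestronglyMeasurable, hu1]; simp
  have hint1 : Integrable (fun y => u y * h y + 1) ν := hint.add (integrable_const 1)
  have hint2 : Integrable (fun y => u y * h y + 1 - u y) ν := hint1.sub huint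
  have hval : ∫ y, (u y * h y + 1 - u y) ∂ν = ∫ y, h y ∂μ := by
    rw [integral_sub hint1 huint, integral_add hint (integrable_const 1), huint1, hμ,
      integral_withDensity_eq_integral_toReal_smul hum hlt]
    simp [ENNReal.toReal_ofReal (hu0 _)]
  -- With `klFun u = u log u + 1 - u`, the integrand is at most `u h + 1 - u`, so integrability of
  -- `log u` is never needed.
  rw [klDiv_eq_lintegral_klFun_of_ac (withDensity_absolutelyContinuous _ _), ← hval,
    ofReal_integral_eq_lintegral_ofReal hint2]
  · refine lintegral_mono_ae ?_
    filter_upwards [Measure.rnDeriv_withDensity ν hum] with y hy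
    rw [hy, ENNReal.toReal_ofReal (hu0 y), klFun_apply]
    gcongr
    · exact hu0 y
    · exact huh y
  · refine ae_of_all _ fun y => ?_
    have h1 := klFun_nonneg (hu0 y)
    have h2 := mul_le_mul_of_nonneg_left (huh y) (hu0 y)
    rw [klFun_apply] at h1
    simp only [Pi.zero_apply]
    linarith

/-- Fenchel-Young: `klFun u - 1 = u log u - u` is the convex conjugate of `exp`. -/
theorem mul_le_klFun_add_exp {u : ℝ} (hu : 0 ≤ u) (g : ℝ) :
    u * g ≤ klFun u - 1 + Real.exp g := by
  rw [klFun_apply]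
  rcases hu.eq_or_lt with rfl | hu
  · simpa using (Real.exp_pos g).le
  · have h1 := Real.add_one_le_exp (g - Real.log u)
    rw [Real.exp_sub, Real.exp_log hu, le_div_iff₀ hu] at h1
    linarith

/-- A variational lower bound for the Kullback-Leibler divergence. -/
theorem ofReal_integral_le_klDiv_add {μ ν : Measure α} [IsProbabilityMeasure μ]
    [IsProbabilityMeasure ν] {l H : α → ℝ} (hl : Integrable l μ) (hlm : Measurable l)
    (hH : Measurable H) (hH0 : ∀ y, 0 ≤ H y) :
    ENNReal.ofReal (∫ y, l y ∂μ + 1) ≤ klDiv μ ν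
      + ∫⁻ y, ENNReal.ofReal (Real.exp (l y - H y)) ∂ν + ∫⁻ y, ENNReal.ofReal (H y) ∂μ := by
  -- In this additive form an infinite term on the right makes the claim trivial; otherwise
  -- finiteness supplies all the integrability needed.
  by_cases hk : klDiv μ ν = ∞
  · simp [hk]
  by_cases h2 : ∫⁻ y, ENNReal.ofReal (Real.exp (l y - H y)) ∂ν = ∞
  · simp [h2]
  by_cases h3 : ∫⁻ y, ENNReal.ofReal (H y) ∂μ = ∞
  · simp [h3]
  obtain ⟨hac, hllr⟩ := klDiv_ne_top_iff.1 hk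
  have hHi : Integrable H μ :=
    (lintegral_ofReal_ne_top_iff_integrable hH.aestronglyMeasurable (ae_of_all _ hH0)).1 h3
  have hem : Measurable fun y => Real.exp (l y - H y) := (hlm.sub hH).exp
  have hei : Integrable (fun y => Real.exp (l y - H y)) ν :=
    (lintegral_ofReal_ne_top_iff_integrable hem.aestronglyMeasurable
      (ae_of_all _ fun _ => (Real.exp_pos _).le)).1 h2
  have hkl : Integrable (fun y => klFun (μ.rnDeriv ν y).toReal) ν :=
    (integrable_klFun_rnDeriv_iff hac).2 hllr
  have hkl0 : 0 ≤ ∫ y, klFun (μ.rnDeriv ν y).toReal ∂ν :=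
    integral_nonneg fun _ => klFun_nonneg ENNReal.toReal_nonneg
  have hkeq : klDiv μ ν = ENNReal.ofReal (∫ y, klFun (μ.rnDeriv ν y).toReal ∂ν) := by
    rw [klDiv_eq_integral_klFun, if_pos ⟨hac, hllr⟩]
  have hgi : Integrable (fun y => l y - H y) μ := hl.sub hHi
  have hu : Integrable (fun y => (μ.rnDeriv ν y).toReal * (l y - H y)) ν := by
    simpa using (integrable_rnDeriv_smul_iff hac).2 hgi
  have hval : ∫ y, (μ.rnDeriv ν y).toReal * (l y - H y) ∂ν = ∫ y, l y ∂μ - ∫ y, H y ∂μ := by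
    rw [← integral_sub hl hHi, ← integral_rnDeriv_smul hac]; simp
  have hkl1 : Integrable (fun y => klFun (μ.rnDeriv ν y).toReal - 1) ν :=
    hkl.sub (integrable_const 1)
  have hmono : ∫ y, (μ.rnDeriv ν y).toReal * (l y - H y) ∂ν
      ≤ ∫ y, (klFun (μ.rnDeriv ν y).toReal - 1 + Real.exp (l y - H y)) ∂ν :=
    integral_mono hu (hkl1.add hei)
      fun y => mul_le_klFun_add_exp ENNReal.toReal_nonneg _
  rw [hval, integral_add hkl1 hei,
    integral_sub hkl (integrable_const 1)] at hmono
  simp only [integral_const, probReal_univ, smul_eq_mul, mul_one] at hmono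
  rw [hkeq, ← ofReal_integral_eq_lintegral_ofReal hei (ae_of_all _ fun _ => (Real.exp_pos _).le),
    ← ofReal_integral_eq_lintegral_ofReal hHi (ae_of_all _ hH0),
    ← ENNReal.ofReal_add hkl0 (integral_nonneg fun _ => (Real.exp_pos _).le),
    ← ENNReal.ofReal_add (add_nonneg hkl0 (integral_nonneg fun _ => (Real.exp_pos _).le))
      (integral_nonneg hH0)]
  exact ENNReal.ofReal_le_ofReal (by linarith)

end klDiv

/-! ### Gaussian moments -/

theorem integrable_sq_sub_gaussianReal (θ c : ℝ) (w : ℝ≥0) :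
    Integrable (fun x => (x - c) ^ 2) (gaussianReal θ w) :=
  ((memLp_id_gaussianReal (μ := θ) (v := w) 2).sub (memLp_const c)).integrable_sq

theorem integrable_id_gaussianReal (θ : ℝ) (w : ℝ≥0) :
    Integrable (fun x => x) (gaussianReal θ w) :=
  (memLp_id_gaussianReal (μ := θ) (v := w) 1).integrable le_rfl

theorem integral_sq_sub_gaussianReal (θ c : ℝ) (w : ℝ≥0) :
    ∫ x, (x - c) ^ 2 ∂(gaussianReal θ w) = w + (θ - c) ^ 2 := by
  have h0 : ∫ x, (x - θ) ^ 2 ∂(gaussianReal θ w) = w := by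
    have := variance_fun_id_gaussianReal (μ := θ) (v := w)
    rw [variance_eq_integral (by fun_prop)] at this
    simpa [integral_id_gaussianReal] using this
  have h1 : ∀ x : ℝ, (x - c) ^ 2 = (x - θ) ^ 2 + (2 * (θ - c) * x + (c ^ 2 - θ ^ 2)) := by
    intro x; ring
  have hi : Integrable (fun x : ℝ => 2 * (θ - c) * x) (gaussianReal θ w) :=
    (integrable_id_gaussianReal θ w).const_mul _
  simp_rw [h1]
  rw [integral_add (integrable_sq_sub_gaussianReal _ _ _) (hi.fun_add (integrable_const _)),
    integral_add hi (integrable_const _), integral_const_mul, h0, integral_id_gaussianReal]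
  simp

theorem lintegral_le_of_le_quadratic {θ : ℝ} {w : ℝ≥0} {f : ℝ → ℝ} {A B : ℝ}
    (hA : 0 ≤ A) (hB : 0 ≤ B) (hf : ∀ x, f x ≤ A + B * (x - θ) ^ 2) :
    ∫⁻ x, ENNReal.ofReal (f x) ∂(gaussianReal θ w) ≤ ENNReal.ofReal (A + B * w) := by
  have hi : Integrable (fun x => B * (x - θ) ^ 2) (gaussianReal θ w) :=
    (integrable_sq_sub_gaussianReal θ θ w).const_mul B
  have hv : ∫ x, (A + B * (x - θ) ^ 2) ∂(gaussianReal θ w) = A + B * w := by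
    rw [integral_add (integrable_const _) hi, integral_const_mul, integral_sq_sub_gaussianReal]
    simp
  rw [← hv, ofReal_integral_eq_lintegral_ofReal ((integrable_const A).fun_add hi)
    (ae_of_all _ fun x => by positivity)]
  exact lintegral_mono fun x => ENNReal.ofReal_le_ofReal (hf x)

theorem lintegral_exp_sq_gaussianReal {b : ℝ} (hb : 0 < b) :
    ∫⁻ x, ENNReal.ofReal (Real.exp ((1 - b) * (x ^ 2 / 2))) ∂(gaussianReal 0 1)
      = ENNReal.ofReal (Real.sqrt b⁻¹) := by
  rw [gaussianReal_of_var_ne_zero _ one_ne_zero, lintegral_withDensity_eq_lintegral_mul _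
    (measurable_gaussianPDF _ _) (by fun_prop)]
  have h1 : ∀ x : ℝ, (gaussianPDF 0 1 * fun x =>
      ENNReal.ofReal (Real.exp ((1 - b) * (x ^ 2 / 2)))) x
      = ENNReal.ofReal ((Real.sqrt (2 * Real.pi))⁻¹ * Real.exp (-(b / 2) * x ^ 2)) := by
    intro x
    rw [Pi.mul_apply, gaussianPDF_def, ← ENNReal.ofReal_mul (gaussianPDFReal_nonneg _ _ _),
      gaussianPDFReal_def]
    simp only [NNReal.coe_one, mul_one, sub_zero]
    rw [mul_assoc, ← Real.exp_add]
    congr 3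
    ring
  simp_rw [h1]
  rw [← ofReal_integral_eq_lintegral_ofReal
    ((integrable_exp_neg_mul_sq (by positivity)).const_mul _) (ae_of_all _ fun x => by positivity),
    integral_const_mul, integral_gaussian, ← Real.sqrt_inv, ← Real.sqrt_mul (by positivity)]
  congr 2
  field_simp

/-! ### Elementary inequalities -/

theorem log_one_add_exp_le (a : ℝ) : Real.log (1 + Real.exp a) ≤ Real.log 2 + max 0 a := by
  rw [← Real.log_exp (max 0 a), ← Real.log_mul two_ne_zero (Real.exp_pos _).ne']
  refine Real.log_le_log (by positivity) ?_
  have h1 := Real.exp_le_exp.2 (le_max_left 0 a)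
  have h2 := Real.exp_le_exp.2 (le_max_right 0 a)
  rw [Real.exp_zero] at h1
  linarith

/-- Subadditivity of `z ↦ z ^ a`, then `log (1 + z) ≤ z`. An exponent `a < 1` matters because
`e^{x²/2}` is not integrable under `N(0, 1)`, while `e^{a x²/2}` is. -/
theorem log_one_add_exp_le_exp_mul {a : ℝ} (ha : 0 < a) (ha1 : a ≤ 1) (t : ℝ) :
    Real.log (1 + Real.exp t) ≤ Real.exp (a * t) / a := by
  have h1 : (1 + Real.exp t) ^ a ≤ 1 + Real.exp (a * t) := by
    have := Real.rpow_add_le_add_rpow zero_le_one (Real.exp_pos t).le ha.le ha1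
    rwa [Real.one_rpow, ← Real.exp_mul, mul_comm t a] at this
  have h2 := Real.log_le_log (by positivity) h1
  rw [Real.log_rpow (by positivity)] at h2
  have h3 := Real.log_le_sub_one_of_pos (x := 1 + Real.exp (a * t)) (by positivity)
  rw [le_div_iff₀ ha]
  linarith

/-! ### A mixture of two normal predictive densities -/

/-- The weight `(1 + η e^{x²/2})⁻¹` of the spike. -/
noncomputable def spikeWeight (η x : ℝ) : ℝ := (1 + η * Real.exp (x ^ 2 / 2))⁻¹

/-- The univariate predictive density mixing `N(0, r)` with weight `spikeWeight η x` and
`N(x, 1 + r)`. It is the Bayes rule for a point mass at zero and a uniform slab. -/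
@[irreducible] noncomputable def mixDensity (r : ℝ≥0) (η x y : ℝ) : ℝ :=
  spikeWeight η x * gaussianPDFReal 0 r y + (1 - spikeWeight η x) * gaussianPDFReal x (1 + r) y

section mixture

variable {r : ℝ≥0} {η : ℝ}

theorem spikeWeight_pos (hη : 0 ≤ η) (x : ℝ) : 0 < spikeWeight η x := by
  unfold spikeWeight; positivity

theorem spikeWeight_le_one (hη : 0 ≤ η) (x : ℝ) : spikeWeight η x ≤ 1 :=
  inv_le_one_of_one_le₀ (le_add_of_nonneg_right (by positivity))

theorem one_sub_spikeWeight (hη : 0 < η) (x : ℝ) :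
    1 - spikeWeight η x = (1 + η⁻¹ * Real.exp (-(x ^ 2 / 2)))⁻¹ := by
  have h : Real.exp (x ^ 2 / 2) ≠ 0 := (Real.exp_pos _).ne'
  have h' : 1 + η * Real.exp (x ^ 2 / 2) ≠ 0 := by positivity
  have h'' : η * Real.exp (x ^ 2 / 2) + 1 ≠ 0 := by positivity
  rw [spikeWeight, Real.exp_neg]
  field_simp
  ring

theorem measurable_mixDensity (r : ℝ≥0) (η : ℝ) :
    Measurable fun p : ℝ × ℝ => mixDensity r η p.1 p.2 := by
  have h : Measurable fun p : ℝ × ℝ => gaussianPDFReal p.1 (1 + r) p.2 :=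
    measurable_uncurry_gaussianPDFReal.comp
      (measurable_fst.prodMk (measurable_const.prodMk measurable_snd))
  have h0 : Measurable fun p : ℝ × ℝ => gaussianPDFReal 0 r p.2 :=
    (measurable_gaussianPDFReal 0 r).comp measurable_snd
  unfold mixDensity spikeWeight
  fun_prop

theorem _root_.Measurable.mixDensity {α : Type*} [MeasurableSpace α] {f g : α → ℝ}
    (hf : Measurable f) (hg : Measurable g) (r : ℝ≥0) (η : ℝ) :
    Measurable fun a => SparsePrediction.mixDensity r η (f a) (g a) :=
  (measurable_mixDensity r η).comp (hf.prodMk hg)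

theorem mixDensity_pos (hr : 0 < r) (hη : 0 ≤ η) (x y : ℝ) : 0 < mixDensity r η x y := by
  rw [mixDensity]
  exact add_pos_of_pos_of_nonneg
    (mul_pos (spikeWeight_pos hη x) (gaussianPDFReal_pos _ _ _ hr.ne'))
    (mul_nonneg (sub_nonneg.2 (spikeWeight_le_one hη x)) (gaussianPDFReal_nonneg _ _ _))

theorem lintegral_mixDensity (hr : 0 < r) (hη : 0 ≤ η) (x : ℝ) :
    ∫⁻ y, ENNReal.ofReal (mixDensity r η x y) = 1 := by
  have h1 := spikeWeight_pos hη x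
  have h2 := sub_nonneg.2 (spikeWeight_le_one hη x)
  have h3 : (1 + r : ℝ≥0) ≠ 0 := by positivity
  simp_rw [mixDensity]
  rw [← ofReal_integral_eq_lintegral_ofReal
    (((integrable_gaussianPDFReal 0 r).const_mul _).fun_add
      ((integrable_gaussianPDFReal x (1 + r)).const_mul _))
    (ae_of_all _ fun y => by
      have := (mixDensity_pos hr hη x y).le
      rwa [mixDensity] at this),
    integral_add ((integrable_gaussianPDFReal 0 r).const_mul _)
      ((integrable_gaussianPDFReal x (1 + r)).const_mul _),
    integral_const_mul, integral_const_mul, integral_gaussianPDFReal_eq_one _ hr.ne',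
    integral_gaussianPDFReal_eq_one _ h3]
  simp

/-- The predictive density with independent `mixDensity` coordinates. -/
noncomputable def mixEstimator (n : ℕ) (hr : 0 < r) (hη : 0 ≤ η) : PredictiveDensity n where
  density x y := ∏ i, ENNReal.ofReal (mixDensity r η (x i) (y i))
  measurable_density := by
    have h (i : Fin n) : Measurable fun p : (Fin n → ℝ) × (Fin n → ℝ) =>
        ENNReal.ofReal (mixDensity r η (p.1 i) (p.2 i)) :=
      (Measurable.mixDensity (by fun_prop) (by fun_prop) r η).ennreal_ofReal
    have h' := Finset.measurable_fun_prod Finset.univ fun i _ => h i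
    exact h'
  lintegral_density x := by
    rw [volume_pi, lintegral_fin_prod (f := fun i y => ENNReal.ofReal (mixDensity r η (x i) y))
      fun i => (measurable_const.mixDensity measurable_id r η).ennreal_ofReal]
    simp [lintegral_mixDensity hr hη]

/-- The log ratio of product densities is a sum over coordinates, so each coordinate may have its
own majorant `h i`. -/
theorem klLoss_mixEstimator_le {n : ℕ} (hr : 0 < r) (hη : 0 ≤ η) (θ x : Fin n → ℝ)
    {h : Fin n → ℝ → ℝ}
    (hh : ∀ i y, Real.log (gaussianPDFReal (θ i) r y / mixDensity r η (x i) y) ≤ h i y)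
    (hi : ∀ i, Integrable (h i) (gaussianReal (θ i) r)) :
    klLoss r θ (mixEstimator n hr hη) x
      ≤ ∑ i, ENNReal.ofReal (∫ y, h i y ∂(gaussianReal (θ i) r)) := by
  have hmeas (i : Fin n) : Measurable fun y => mixDensity r η (x i) y :=
    measurable_const.mixDensity measurable_id r η
  have hmp (i : Fin n) (y : ℝ) := mixDensity_pos hr hη (x i) y
  have hgp (i : Fin n) (y : ℝ) := gaussianPDFReal_pos (θ i) r y hr.ne'
  set ν : Measure (Fin n → ℝ) := volume.withDensity ((mixEstimator n hr hη).density x) with hν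
  have : IsProbabilityMeasure ν := ⟨by
    rw [hν, withDensity_apply _ MeasurableSet.univ, Measure.restrict_univ]
    exact (mixEstimator n hr hη).lintegral_density x⟩
  set u : (Fin n → ℝ) → ℝ := fun y =>
    ∏ i, (gaussianPDFReal (θ i) r (y i) / mixDensity r η (x i) (y i)) with hu
  have hum : Measurable u := Finset.measurable_fun_prod _ fun i _ =>
    ((measurable_gaussianPDFReal _ _).div (hmeas i)).comp (measurable_pi_apply i)
  have hlaw : normalLaw θ r = ν.withDensity fun y => ENNReal.ofReal (u y) := by
    have hd : Measurable ((mixEstimator n hr hη).density x) :=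
      (mixEstimator n hr hη).measurable_density.comp measurable_prodMk_left
    rw [normalLaw_eq_withDensity θ hr.ne', hν,
      ← withDensity_mul _ hd hum.ennreal_ofReal]
    congr 1
    ext y
    simp only [mixEstimator, Pi.mul_apply, hu]
    rw [ENNReal.ofReal_prod_of_nonneg fun i _ => (div_pos (hgp i _) (hmp i _)).le,
      ← Finset.prod_mul_distrib]
    refine Finset.prod_congr rfl fun i _ => ?_
    rw [← ENNReal.ofReal_mul (hmp i _).le, mul_div_cancel₀ _ (hmp i _).ne']
    rfl
  have hinst : IsProbabilityMeasure (ν.withDensity fun y => ENNReal.ofReal (u y)) := by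
    rw [← hlaw]; infer_instance
  have hie (i : Fin n) : Integrable (fun y : Fin n → ℝ => h i (y i)) (normalLaw θ r) :=
    integrable_comp_eval (hi i)
  have key := klDiv_withDensity_le (ν := ν) (h := fun y => ∑ i, h i (y i)) hum
    (fun y => Finset.prod_nonneg fun i _ => (div_pos (hgp i _) (hmp i _)).le)
    (fun y => by
      rw [hu, Real.log_prod fun i _ => (div_pos (hgp i _) (hmp i _)).ne']
      exact Finset.sum_le_sum fun i _ => hh i (y i))
    (by rw [← hlaw]; exact integrable_finsetSum _ fun i _ => hie i)
  rw [← hlaw, integral_finsetSum _ fun i _ => hie i] at key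
  refine key.trans ?_
  have he (i : Fin n) : ∫ y, h i (y i) ∂(normalLaw θ r) = ∫ y, h i y ∂(gaussianReal (θ i) r) :=
    integral_comp_eval (hi i).aestronglyMeasurable
  simp_rw [he]
  exact Finset.le_sum_of_subadditive _ ENNReal.ofReal_zero.le (fun _ _ => ENNReal.ofReal_add_le) _ _

/-- A bound for the loss of `mixDensity r η x` at `θ`, by comparison with its spike. -/
noncomputable def spikeLoss (r : ℝ≥0) (η θ x : ℝ) : ℝ :=
  Real.log (1 + η * Real.exp (x ^ 2 / 2)) + θ ^ 2 / (2 * r)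

/-- A bound for the loss of `mixDensity r η x` at `θ`, by comparison with its slab. -/
noncomputable def slabLoss (r : ℝ≥0) (η θ x : ℝ) : ℝ :=
  Real.log (1 + η⁻¹ * Real.exp (-(x ^ 2 / 2))) + 1 / (2 * r) - 1 / 2
    + (r + (θ - x) ^ 2) / (2 * (1 + r))

/-- Dropping the slab from the mixture leaves a log ratio that is affine in `y`. The case `η = 0`, a
pure spike, is allowed and serves part (a). -/
theorem exists_spike_bound (hr : 0 < r) (hη : 0 ≤ η) (θ x : ℝ) : ∃ h : ℝ → ℝ,
    (∀ y, Real.log (gaussianPDFReal θ r y / mixDensity r η x y) ≤ h y) ∧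
    Integrable h (gaussianReal θ r) ∧ ∫ y, h y ∂(gaussianReal θ r) = spikeLoss r η θ x := by
  have hr' : (0 : ℝ) < r := hr
  refine ⟨fun y => Real.log (1 + η * Real.exp (x ^ 2 / 2)) + (θ / r * y - θ ^ 2 / (2 * r)),
    fun y => ?_, ?_, ?_⟩ <;> beta_reduce
  · have hw := spikeWeight_pos hη x
    have hg := gaussianPDFReal_pos θ r y hr.ne'
    have h0 := gaussianPDFReal_pos 0 r y hr.ne'
    have hle : gaussianPDFReal θ r y / mixDensity r η x y
        ≤ gaussianPDFReal θ r y / (spikeWeight η x * gaussianPDFReal 0 r y) := by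
      refine div_le_div_of_nonneg_left hg.le (mul_pos hw h0) ?_
      rw [mixDensity]
      exact le_add_of_nonneg_right (mul_nonneg (sub_nonneg.2 (spikeWeight_le_one hη x))
        (gaussianPDFReal_nonneg _ _ _))
    refine (Real.log_le_log (div_pos hg (mixDensity_pos hr hη x y)) hle).trans_eq ?_
    have hq : gaussianPDFReal θ r y / (spikeWeight η x * gaussianPDFReal 0 r y)
        = (1 + η * Real.exp (x ^ 2 / 2)) * Real.exp (θ / r * y - θ ^ 2 / (2 * r)) := by
      rw [div_eq_iff (mul_pos hw h0).ne', spikeWeight, gaussianPDFReal_def, gaussianPDFReal_def]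
      have h1 : 1 + η * Real.exp (x ^ 2 / 2) ≠ 0 := by positivity
      have h2 : Real.exp (-(y - θ) ^ 2 / (2 * r))
          = Real.exp (θ / r * y - θ ^ 2 / (2 * r)) * Real.exp (-(y - 0) ^ 2 / (2 * r)) := by
        rw [← Real.exp_add]; congr 1; field_simp; ring
      simp only
      rw [h2]
      field_simp
    rw [hq, Real.log_mul (by positivity) (Real.exp_pos _).ne', Real.log_exp]
  · exact (integrable_const _).add
      (((integrable_id_gaussianReal θ r).const_mul _).sub (integrable_const _))
  · have hi : Integrable (fun y => θ / r * y) (gaussianReal θ r) :=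
      (integrable_id_gaussianReal θ r).const_mul _
    rw [integral_add (integrable_const _) (hi.sub' (integrable_const _)),
      integral_sub hi (integrable_const _), integral_const_mul, integral_id_gaussianReal]
    simp only [integral_const, probReal_univ, smul_eq_mul, one_mul, spikeLoss]
    field_simp
    ring

/-- Dropping the spike leaves a log ratio that is quadratic in `y`. Here `η > 0` is needed for the
slab to have positive weight. -/
theorem exists_slab_bound (hr : 0 < r) (hη : 0 < η) (θ x : ℝ) : ∃ h : ℝ → ℝ,
    (∀ y, Real.log (gaussianPDFReal θ r y / mixDensity r η x y) ≤ h y) ∧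
    Integrable h (gaussianReal θ r) ∧ ∫ y, h y ∂(gaussianReal θ r) = slabLoss r η θ x := by
  have hr' : (0 : ℝ) < r := hr
  have hr1 : (1 + r : ℝ≥0) ≠ 0 := by positivity
  refine ⟨fun y => (Real.log (1 + η⁻¹ * Real.exp (-(x ^ 2 / 2))) + 1 / (2 * r))
    + ((2 * (1 + r : ℝ))⁻¹ * (y - x) ^ 2 - (2 * (r : ℝ))⁻¹ * (y - θ) ^ 2), fun y => ?_, ?_, ?_⟩ <;> beta_reduce
  · have hw : 0 < 1 - spikeWeight η x := by
      rw [one_sub_spikeWeight hη]; positivity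
    have hg := gaussianPDFReal_pos θ r y hr.ne'
    have h0 := gaussianPDFReal_pos x (1 + r) y hr1
    have hle : gaussianPDFReal θ r y / mixDensity r η x y
        ≤ gaussianPDFReal θ r y / ((1 - spikeWeight η x) * gaussianPDFReal x (1 + r) y) := by
      refine div_le_div_of_nonneg_left hg.le (mul_pos hw h0) ?_
      rw [mixDensity]
      exact le_add_of_nonneg_left (mul_nonneg (spikeWeight_pos hη.le x).le
        (gaussianPDFReal_nonneg _ _ _))
    refine (Real.log_le_log (div_pos hg (mixDensity_pos hr hη.le x y)) hle).trans ?_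
    rw [one_sub_spikeWeight hη, Real.log_div hg.ne' (by positivity),
      Real.log_mul (by positivity) h0.ne', Real.log_inv, gaussianPDFReal_def, gaussianPDFReal_def]
    simp only [NNReal.coe_add, NNReal.coe_one]
    rw [Real.log_mul (by positivity) (Real.exp_pos _).ne',
      Real.log_mul (by positivity) (Real.exp_pos _).ne', Real.log_exp, Real.log_exp,
      Real.log_inv, Real.log_inv, Real.log_sqrt (by positivity), Real.log_sqrt (by positivity),
      Real.log_mul (y := (r : ℝ)) (by positivity) (by positivity),
      Real.log_mul (y := (1 + r : ℝ)) (by positivity) (by positivity)]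
    -- The normalising constants contribute `log ((1 + r) / r) / 2`, which is the source of `1 / (2
    -- * r)` in `slabLoss`.
    have h1 : Real.log (1 + r) - Real.log r ≤ 1 / r := by
      rw [← Real.log_div (by positivity) (by positivity)]
      refine (Real.log_le_sub_one_of_pos (by positivity)).trans_eq ?_
      field_simp
      ring
    have h2 : -(y - θ) ^ 2 / (2 * r) = -((2 * (r : ℝ))⁻¹ * (y - θ) ^ 2) := by ring
    have h3 : -(y - x) ^ 2 / (2 * (1 + r)) = -((2 * (1 + r : ℝ))⁻¹ * (y - x) ^ 2) := by ring
    have h4 : 1 / (2 * r : ℝ) = 1 / 2 * (1 / r) := by ring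
    rw [h2, h3, h4]
    linarith
  · exact (integrable_const _).add (((integrable_sq_sub_gaussianReal _ _ _).const_mul _).sub
      ((integrable_sq_sub_gaussianReal _ _ _).const_mul _))
  · have hi : Integrable (fun y => (2 * (1 + r : ℝ))⁻¹ * (y - x) ^ 2) (gaussianReal θ r) :=
      (integrable_sq_sub_gaussianReal θ x r).const_mul _
    have hi' := (integrable_sq_sub_gaussianReal θ θ r).const_mul (2 * (r : ℝ))⁻¹
    rw [integral_add (integrable_const _) (hi.sub' hi'), integral_sub hi hi',
      integral_const_mul, integral_const_mul, integral_sq_sub_gaussianReal,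
      integral_sq_sub_gaussianReal]
    simp only [integral_const, probReal_univ, smul_eq_mul, one_mul, slabLoss]
    field_simp
    ring

/-- The component used for comparison may depend on the unknown `θ i`: the estimator dominates both
at once and the choice enters only the analysis. -/
theorem klRisk_mixEstimator_le {n : ℕ} (hr : 0 < r) (hη : 0 ≤ η) (θ : Fin n → ℝ)
    {b : Fin n → ℝ≥0∞}
    (hb : ∀ i, ∫⁻ x, ENNReal.ofReal (spikeLoss r η (θ i) x) ∂(gaussianReal (θ i) 1) ≤ b i ∨
      0 < η ∧ ∫⁻ x, ENNReal.ofReal (slabLoss r η (θ i) x) ∂(gaussianReal (θ i) 1) ≤ b i) :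
    klRisk r θ (mixEstimator n hr hη) ≤ ∑ i, b i := by
  have key (i : Fin n) : ∃ g : ℝ → ℝ, Measurable g ∧
      ∫⁻ x, ENNReal.ofReal (g x) ∂(gaussianReal (θ i) 1) ≤ b i ∧
      ∀ x, ∃ h : ℝ → ℝ,
        (∀ y, Real.log (gaussianPDFReal (θ i) r y / mixDensity r η x y) ≤ h y) ∧
        Integrable h (gaussianReal (θ i) r) ∧ ∫ y, h y ∂(gaussianReal (θ i) r) = g x := by
    rcases hb i with h | ⟨h0, h⟩
    · exact ⟨spikeLoss r η (θ i), by unfold spikeLoss; fun_prop, h,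
        exists_spike_bound hr hη (θ i)⟩
    · exact ⟨slabLoss r η (θ i), by unfold slabLoss; fun_prop, h,
        exists_slab_bound hr h0 (θ i)⟩
  choose g hgm hgb h hh hi hv using key
  calc klRisk r θ (mixEstimator n hr hη)
      ≤ ∫⁻ x, ∑ i, ENNReal.ofReal (g i (x i)) ∂(normalLaw θ 1) := by
        refine lintegral_mono fun x => ?_
        refine (klLoss_mixEstimator_le hr hη θ x (fun i => hh i (x i))
          fun i => hi i (x i)).trans_eq ?_
        simp_rw [hv]
    _ = ∑ i, ∫⁻ x, ENNReal.ofReal (g i (x i)) ∂(normalLaw θ 1) :=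
        lintegral_finsetSum _ fun i _ =>
          ((hgm i).comp (measurable_pi_apply i)).ennreal_ofReal
    _ ≤ ∑ i, b i := by
        refine Finset.sum_le_sum fun i _ => ?_
        rw [lintegral_normalLaw_eval θ 1 i (hgm i).ennreal_ofReal]
        exact hgb i

end mixture

/-! ### Upper bounds for the minimax risk -/

theorem sum_ite_ne_zero {n : ℕ} (θ : Fin n → ℝ) (c : ℝ≥0∞) :
    ∑ i, (if θ i ≠ 0 then c else 0) = hammingNorm θ * c := by
  rw [← Finset.sum_filter, Finset.sum_const, nsmul_eq_mul, hammingNorm]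

theorem minimaxRisk_boundedSparseSet_le {r : ℝ≥0} (hr : 0 < r) (n s : ℕ) (t : ℝ) :
    minimaxRisk r (boundedSparseSet n s t) ≤ ENNReal.ofReal (s * t ^ 2 / (2 * r)) := by
  have hr' : (0 : ℝ) < r := hr
  -- `le_rfl` sets `η = 0`, so the estimator is `N(0, r I)` whatever `x` is.
  refine iInf_le_of_le (mixEstimator n hr le_rfl) (iSup₂_le fun θ hθ => ?_)
  have key := klRisk_mixEstimator_le hr le_rfl θ
    (b := fun i => if θ i ≠ 0 then ENNReal.ofReal (t ^ 2 / (2 * r)) else 0) fun i => Or.inl ?_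
  · refine key.trans ?_
    rw [sum_ite_ne_zero, mul_div_assoc, ENNReal.ofReal_mul (by positivity), ENNReal.ofReal_natCast]
    gcongr
    exact hθ.1
  · simp only [spikeLoss, zero_mul, add_zero, Real.log_one, zero_add, lintegral_const,
      measure_univ, mul_one]
    split_ifs with h
    · refine ENNReal.ofReal_le_ofReal (div_le_div_of_nonneg_right ?_ (by positivity))
      exact sq_le_sq.2 ((hθ.2 i).trans (le_abs_self t))
    · simp [not_not.1 h]

/-! ### Risk of a single coordinate at `η = e^{-L}`. -/

section oneDim

variable {r : ℝ≥0} {L : ℝ}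

/-- Take `a = 1 - 1 / L` in `log_one_add_exp_le_exp_mul`: then `η ^ a = e η` and `E e^{a X²/2} =
√L`. The factor 6 is `3 * 2`, from `e ≤ 3` and `1 / a ≤ 2`. -/
theorem lintegral_spikeLoss_zero_le (r : ℝ≥0) (hL : 2 ≤ L) :
    ∫⁻ x, ENNReal.ofReal (spikeLoss r (Real.exp (-L)) 0 x) ∂(gaussianReal 0 1)
      ≤ ENNReal.ofReal (6 * Real.exp (-L) * Real.sqrt L) := by
  have hL0 : 0 < L := by linarith
  have hLi : L⁻¹ ≤ 1 / 2 := by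
    rw [one_div]; exact inv_anti₀ two_pos hL
  have hLi0 : 0 < L⁻¹ := inv_pos.2 hL0
  have hb : ∀ x : ℝ, spikeLoss r (Real.exp (-L)) 0 x
      ≤ 6 * Real.exp (-L) * Real.exp ((1 - L⁻¹) * (x ^ 2 / 2)) := by
    intro x
    have h1 := log_one_add_exp_le_exp_mul (a := 1 - L⁻¹) (by linarith) (by linarith)
      (-L + x ^ 2 / 2)
    have h2 : (1 - L⁻¹) * (-L + x ^ 2 / 2) = 1 + -L + (1 - L⁻¹) * (x ^ 2 / 2) := by
      field_simp; ring
    rw [spikeLoss, ← Real.exp_add]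
    simp only [ne_eq, OfNat.ofNat_ne_zero, not_false_eq_true, zero_pow, zero_div, add_zero]
    refine h1.trans ?_
    rw [h2, div_le_iff₀ (by linarith), Real.exp_add, Real.exp_add]
    have h3 : Real.exp 1 ≤ 3 := Real.exp_one_lt_three.le
    have h4 : 0 < Real.exp (-L) * Real.exp ((1 - L⁻¹) * (x ^ 2 / 2)) := by positivity
    nlinarith [mul_le_mul_of_nonneg_right h3 h4.le]
  calc _ ≤ ∫⁻ x, ENNReal.ofReal (6 * Real.exp (-L))
          * ENNReal.ofReal (Real.exp ((1 - L⁻¹) * (x ^ 2 / 2))) ∂(gaussianReal 0 1) := by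
        refine lintegral_mono fun x => ?_
        rw [← ENNReal.ofReal_mul (by positivity)]
        exact ENNReal.ofReal_le_ofReal (hb x)
    _ = _ := by
        rw [lintegral_const_mul _ (by fun_prop), lintegral_exp_sq_gaussianReal hLi0, inv_inv,
          ← ENNReal.ofReal_mul (by positivity)]

/-- Young's inequality with weight `r` gives `x² / 2 ≤ (1 + 1 / r) θ² / 2 + (1 + r) / 2 * (x - θ)²`,
whose first term is at most `L`; so the log of the weight costs only `O(1)` on average. -/
theorem lintegral_spikeLoss_le (hr : 0 < r) (hL : 1 ≤ L) {θ : ℝ}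
    (hθ : θ ^ 2 / 2 ≤ r / (1 + r) * L) :
    ∫⁻ x, ENNReal.ofReal (spikeLoss r (Real.exp (-L)) θ x) ∂(gaussianReal θ 1)
      ≤ ENNReal.ofReal (L / (1 + r) + (3 + r + 1 / r) * Real.sqrt L) := by
  have hr' : (0 : ℝ) < r := hr
  have hs : 1 ≤ Real.sqrt L := Real.one_le_sqrt.2 hL
  have hq : (1 + 1 / (r : ℝ)) * (θ ^ 2 / 2) ≤ L := by
    have := mul_le_mul_of_nonneg_left hθ (show 0 ≤ 1 + 1 / (r : ℝ) by positivity)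
    refine this.trans_eq ?_
    field_simp
    ring
  have hq' : θ ^ 2 / (2 * r) ≤ L / (1 + r) := by
    have := mul_le_mul_of_nonneg_left hθ (show 0 ≤ 1 / (r : ℝ) by positivity)
    calc θ ^ 2 / (2 * r) = 1 / r * (θ ^ 2 / 2) := by ring
      _ ≤ _ := this
      _ = _ := by field_simp
  have hb := lintegral_le_of_le_quadratic (θ := θ) (w := 1)
    (f := spikeLoss r (Real.exp (-L)) θ) (A := Real.log 2 + L / (1 + r)) (B := (1 + r) / 2)
    (by have := Real.log_pos one_lt_two; positivity) (by positivity) fun x => by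
      have h1 := log_one_add_exp_le (-L + x ^ 2 / 2)
      have h2 : max 0 (-L + x ^ 2 / 2) ≤ (1 + r) / 2 * (x - θ) ^ 2 := by
        refine max_le (by positivity) ?_
        have h3 : 0 ≤ (r * (x - θ) - θ) ^ 2 / (2 * r) := by positivity
        have h4 : (r * (x - θ) - θ) ^ 2 / (2 * r) =
            (1 + r) / 2 * (x - θ) ^ 2 + (1 + 1 / (r : ℝ)) * (θ ^ 2 / 2) - x ^ 2 / 2 := by
          field_simp; ring
        linarith
      rw [spikeLoss, ← Real.exp_add]
      linarith
  refine hb.trans (ENNReal.ofReal_le_ofReal ?_)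
  have h2 := Real.log_two_lt_d9
  have h5 : 3 + r + 1 / (r : ℝ) ≤ (3 + r + 1 / (r : ℝ)) * Real.sqrt L :=
    le_mul_of_one_le_right (by positivity) hs
  have h6 : 0 < 1 / (r : ℝ) := by positivity
  simp only [NNReal.coe_one, mul_one]
  linarith

/-- The weight costs about `L - x² / 2`, hence about `L - θ² / 2 ≤ L / (1 + r)`. Since `θ` is
unbounded, the cross term `θ (x - θ)` is absorbed into the fraction `1 / √L` of `θ² / 2`, at a price
of order `√L`. -/
theorem lintegral_slabLoss_le (hr : 0 < r) (hL : 1 ≤ L) {θ : ℝ}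
    (hθ : r / (1 + r) * L ≤ θ ^ 2 / 2) :
    ∫⁻ x, ENNReal.ofReal (slabLoss r (Real.exp (-L)) θ x) ∂(gaussianReal θ 1)
      ≤ ENNReal.ofReal (L / (1 + r) + (3 + r + 1 / r) * Real.sqrt L) := by
  have hr' : (0 : ℝ) < r := hr
  have hs : 1 ≤ Real.sqrt L := Real.one_le_sqrt.2 hL
  have hs0 : 0 < Real.sqrt L := by linarith
  have hss : Real.sqrt L * Real.sqrt L = L := Real.mul_self_sqrt (by linarith)
  set σ := Real.sqrt L with hσ
  have hv : L - r / (1 + r) * L = L / (1 + r) := by field_simp; ring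
  have hv1 : (r : ℝ) / (1 + r) ≤ 1 := (div_le_one (by positivity)).2 (by linarith)
  have hlog := Real.log_pos one_lt_two
  have hb := lintegral_le_of_le_quadratic (θ := θ) (w := 1)
    (f := slabLoss r (Real.exp (-L)) θ)
    (A := Real.log 2 + (L / (1 + r) + σ) + 1 / (2 * r)) (B := σ / 2 + 1 / 2)
    (by positivity) (by positivity) fun x => by
      have h1 := log_one_add_exp_le (L + -(x ^ 2 / 2))
      have h2 : max 0 (L + -(x ^ 2 / 2)) ≤ L / (1 + r) + σ + σ / 2 * (x - θ) ^ 2 := by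
        refine max_le (by positivity) ?_
        have h3 : 0 ≤ (θ + σ * (x - θ)) ^ 2 / (2 * σ) := by positivity
        have h4 : (θ + σ * (x - θ)) ^ 2 / (2 * σ)
            = σ⁻¹ * (θ ^ 2 / 2) + θ * (x - θ) + σ / 2 * (x - θ) ^ 2 := by
          field_simp; ring
        have h5 : (1 - σ⁻¹) * (r / (1 + r) * L) ≤ (1 - σ⁻¹) * (θ ^ 2 / 2) :=
          mul_le_mul_of_nonneg_left hθ (sub_nonneg.2 (inv_le_one_of_one_le₀ hs))
        have h6 : σ⁻¹ * (r / (1 + r) * L) ≤ σ := by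
          rw [← hss]
          calc σ⁻¹ * (r / (1 + r) * (σ * σ)) = r / (1 + r) * σ := by field_simp
            _ ≤ 1 * σ := mul_le_mul_of_nonneg_right hv1 hs0.le
            _ = σ := one_mul σ
        nlinarith [sq_nonneg (x - θ)]
      have h7 : (r + (θ - x) ^ 2) / (2 * (1 + r)) ≤ 1 / 2 + 1 / 2 * (x - θ) ^ 2 := by
        rw [div_le_iff₀ (by positivity)]
        nlinarith [sq_nonneg (x - θ), mul_nonneg hr'.le (sq_nonneg (x - θ))]
      rw [slabLoss, ← Real.exp_neg, neg_neg, ← Real.exp_add]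
      linarith
  refine hb.trans (ENNReal.ofReal_le_ofReal ?_)
  have h2 := Real.log_two_lt_d9
  have h5 : 1 + r + 1 / (r : ℝ) ≤ (1 + r + 1 / (r : ℝ)) * σ :=
    le_mul_of_one_le_right (by positivity) hs
  have h6 : 1 / (2 * (r : ℝ)) ≤ 1 / r := by
    rw [one_div, one_div, mul_inv]
    have : 0 < (r : ℝ)⁻¹ := by positivity
    linarith
  simp only [NNReal.coe_one, mul_one]
  nlinarith

end oneDim

theorem minimaxRisk_sparseSet_le {r : ℝ≥0} (hr : 0 < r) {n s : ℕ} (hn : 0 < n) (hs : 0 < s)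
    {L : ℝ} (hL : L = Real.log (n / s)) (hL2 : 2 ≤ L) :
    minimaxRisk r (sparseSet n s)
      ≤ ENNReal.ofReal (s * (L / (1 + r) + (9 + r + 1 / r) * Real.sqrt L)) := by
  have hr' : (0 : ℝ) < r := hr
  have hn' : (0 : ℝ) < n := Nat.cast_pos.2 hn
  have hs' : (0 : ℝ) < s := Nat.cast_pos.2 hs
  have hη : Real.exp (-L) = s / n := by
    rw [Real.exp_neg, hL, Real.exp_log (by positivity), inv_div]
  have hη0 := Real.exp_pos (-L)
  set δ := ENNReal.ofReal (6 * Real.exp (-L) * Real.sqrt L) with hδ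
  set M := ENNReal.ofReal (L / (1 + r) + (3 + r + 1 / r) * Real.sqrt L) with hM
  refine iInf_le_of_le (mixEstimator n hr hη0.le) (iSup₂_le fun θ hθ => ?_)
  have key := klRisk_mixEstimator_le hr hη0.le θ
    (b := fun i => δ + if θ i ≠ 0 then M else 0) fun i => ?_
  · refine key.trans ?_
    -- All `n` coordinates are charged `δ`, including the nonzero ones; `n η = s` keeps the total at
    -- order `s √L`.
    have hsum : ∑ i : Fin n, δ = ENNReal.ofReal (s * (6 * Real.sqrt L)) := by
      rw [Finset.sum_const, Finset.card_univ, Fintype.card_fin, nsmul_eq_mul, hδ, hη,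
        ← ENNReal.ofReal_natCast, ← ENNReal.ofReal_mul (by positivity)]
      congr 1
      field_simp
    rw [Finset.sum_add_distrib, sum_ite_ne_zero, hsum]
    calc _ ≤ ENNReal.ofReal (s * (6 * Real.sqrt L)) + (s : ℝ≥0∞) * M := by
          gcongr
          exact hθ
      _ = _ := by
          rw [hM, ← ENNReal.ofReal_natCast, ← ENNReal.ofReal_mul (by positivity),
            ← ENNReal.ofReal_add (by positivity) (by positivity)]
          congr 1
          ring
  · by_cases h : θ i = 0
    · rw [h]
      exact Or.inl ((lintegral_spikeLoss_zero_le r hL2).trans le_self_add)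
    · simp only [ne_eq, h, not_false_eq_true, if_true]
      -- The threshold is `λ² / 2`, where both comparisons have leading cost `L / (1 + r)`.
      rcases le_total (θ i ^ 2 / 2) (r / (1 + r) * L) with h' | h'
      · exact Or.inl ((lintegral_spikeLoss_le hr (by linarith) h').trans le_add_self)
      · exact Or.inr ⟨hη0, (lintegral_slabLoss_le hr (by linarith) h').trans le_add_self⟩

/-! ### A Bayes lower bound for the minimax risk -/

/-- The logarithm of the likelihood ratio of `N_n(θ, I)` to `N_n(0, I)`. -/
noncomputable def logLik {n : ℕ} (θ x : Fin n → ℝ) : ℝ := ∑ i, (θ i * x i - θ i ^ 2 / 2)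

theorem measurable_logLik {n : ℕ} (θ : Fin n → ℝ) : Measurable (logLik θ) := by
  unfold logLik; fun_prop

theorem normalLaw_one_eq_withDensity {n : ℕ} (θ : Fin n → ℝ) :
    normalLaw θ 1
      = (normalLaw 0 1).withDensity fun x => ENNReal.ofReal (Real.exp (logLik θ x)) := by
  have hm : Measurable fun x : Fin n → ℝ => ∏ i, gaussianPDF (0 : ℝ) 1 (x i) :=
    Finset.measurable_fun_prod _ fun i _ =>
      (measurable_gaussianPDF 0 1).comp (measurable_pi_apply i)
  rw [normalLaw_eq_withDensity θ one_ne_zero, normalLaw_eq_withDensity 0 one_ne_zero,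
    Pi.zero_def, ← withDensity_mul _ hm (measurable_logLik θ).exp.ennreal_ofReal]
  congr 1
  ext x
  rw [Pi.mul_apply, logLik, Real.exp_sum,
    ENNReal.ofReal_prod_of_nonneg fun i _ => (Real.exp_pos _).le, ← Finset.prod_mul_distrib]
  refine Finset.prod_congr rfl fun i _ => ?_
  rw [gaussianPDF_def, gaussianPDF_def, ← ENNReal.ofReal_mul (gaussianPDFReal_nonneg _ _ _),
    gaussianPDFReal_def, gaussianPDFReal_def]
  simp only
  rw [mul_assoc _ (Real.exp _) (Real.exp _), ← Real.exp_add]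
  congr 3
  simp only [NNReal.coe_one]
  ring

/-- `logLik θ` is affine, so its mean does not see the variance `w`. This lets `logLik θ y / r`
serve as the log-likelihood ratio for `Y`. -/
theorem integrable_integral_logLik {n : ℕ} (θ : Fin n → ℝ) (w : ℝ≥0) :
    Integrable (logLik θ) (normalLaw θ w) ∧
      ∫ x, logLik θ x ∂(normalLaw θ w) = ∑ i, θ i ^ 2 / 2 := by
  have hl (i : Fin n) : Integrable (fun x => θ i * x) (gaussianReal (θ i) w) :=
    (integrable_id_gaussianReal _ _).const_mul _
  have hi (i : Fin n) : Integrable (fun x => θ i * x - θ i ^ 2 / 2) (gaussianReal (θ i) w) :=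
    (hl i).sub (integrable_const _)
  have he (i : Fin n) :
      Integrable (fun x : Fin n → ℝ => θ i * x i - θ i ^ 2 / 2) (normalLaw θ w) :=
    integrable_comp_eval (μ := fun i => gaussianReal (θ i) w)
      (f := fun x : ℝ => θ i * x - θ i ^ 2 / 2) (hi i)
  refine ⟨integrable_finsetSum _ fun i _ => he i, ?_⟩
  simp only [logLik]
  rw [integral_finsetSum _ fun i _ => he i]
  refine Finset.sum_congr rfl fun i _ => ?_
  have h1 : ∫ x, (θ i * x i - θ i ^ 2 / 2) ∂(normalLaw θ w)
      = ∫ x, (θ i * x - θ i ^ 2 / 2) ∂(gaussianReal (θ i) w) :=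
    integral_comp_eval (μ := fun i => gaussianReal (θ i) w) (f := fun x : ℝ => θ i * x - θ i ^ 2 / 2)
      (hi i).aestronglyMeasurable
  rw [h1, integral_sub (hl i) (integrable_const _), integral_const_mul, integral_id_gaussianReal]
  simp only [integral_const, probReal_univ, smul_eq_mul, one_mul]
  ring

theorem ofReal_le_klLoss_add {n : ℕ} (r : ℝ≥0) (θ : Fin n → ℝ) (p : PredictiveDensity n)
    (x : Fin n → ℝ) {H : (Fin n → ℝ) → ℝ} (hH : Measurable H) (hH0 : ∀ y, 0 ≤ H y) :
    ENNReal.ofReal ((∑ i, θ i ^ 2 / 2) / r + 1) ≤ klLoss r θ p x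
      + (∫⁻ y, p.density x y * ENNReal.ofReal (Real.exp (logLik θ y / r - H y)))
      + ∫⁻ y, ENNReal.ofReal (H y) ∂(normalLaw θ r) := by
  have hd : Measurable (p.density x) := p.measurable_density.comp measurable_prodMk_left
  have : IsProbabilityMeasure (volume.withDensity (p.density x)) := ⟨by
    rw [withDensity_apply _ MeasurableSet.univ, Measure.restrict_univ, p.lintegral_density]⟩
  have hlm : Measurable fun y => logLik θ y / r := (measurable_logLik θ).div_const _
  have hem : Measurable fun y => ENNReal.ofReal (Real.exp (logLik θ y / r - H y)) :=
    (hlm.sub hH).exp.ennreal_ofReal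
  obtain ⟨hli, hlv⟩ := integrable_integral_logLik θ r
  have key := ofReal_integral_le_klDiv_add (ν := volume.withDensity (p.density x))
    (hli.div_const (r : ℝ)) hlm hH hH0
  rw [integral_div, hlv, lintegral_withDensity_eq_lintegral_mul _ hd hem] at key
  exact key

/-- Test the loss at `θ f` against `logLik (θ f) y / r - H f x y` and average over the uniform prior
on `ι`. By `hsum` the exponential terms average to at most `1`, cancelling the `1` of the
variational bound, so only the mean of `H` is lost. -/
theorem ofReal_le_minimaxRisk_add {n : ℕ} {r : ℝ≥0} {ι : Type*} [Fintype ι] [Nonempty ι]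
    {Θ : Set (Fin n → ℝ)} (θ : ι → Fin n → ℝ) (hθ : ∀ f, θ f ∈ Θ)
    (H : ι → (Fin n → ℝ) → (Fin n → ℝ) → ℝ)
    (hH : ∀ f, Measurable fun z : (Fin n → ℝ) × (Fin n → ℝ) => H f z.1 z.2)
    (hH0 : ∀ f x y, 0 ≤ H f x y)
    (hsum : ∀ x y, ∑ f, Real.exp (logLik (θ f) x + (logLik (θ f) y / r - H f x y))
      ≤ Fintype.card ι)
    {K : ℝ} (hK0 : 0 ≤ K) (hK : ∀ f, K ≤ (∑ i, θ f i ^ 2 / 2) / r) {E : ℝ≥0∞}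
    (hE : ∀ f, ∫⁻ x, ∫⁻ y, ENNReal.ofReal (H f x y) ∂(normalLaw (θ f) r) ∂(normalLaw (θ f) 1)
      ≤ E) :
    ENNReal.ofReal K ≤ minimaxRisk r Θ + E := by
  rw [minimaxRisk, ENNReal.iInf_add]
  refine le_iInf fun p => ?_
  set R := ⨆ θ ∈ Θ, klRisk r θ p with hR
  set W : ι → (Fin n → ℝ) → (Fin n → ℝ) → ℝ≥0∞ := fun f x y =>
    p.density x y * ENNReal.ofReal (Real.exp (logLik (θ f) y / r - H f x y)) with hW
  have hWm (f : ι) : Measurable fun z : (Fin n → ℝ) × (Fin n → ℝ) => W f z.1 z.2 :=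
    p.measurable_density.mul ((((measurable_logLik (θ f)).comp measurable_snd).div_const _).sub
      (hH f)).exp.ennreal_ofReal
  have hWi (f : ι) : Measurable fun x => ∫⁻ y, W f x y := (hWm f).lintegral_prod_right'
  have hWx (f : ι) (x : Fin n → ℝ) : Measurable fun y => W f x y :=
    (hWm f).comp measurable_prodMk_left
  have hHi (f : ι) :
      Measurable fun x => ∫⁻ y, ENNReal.ofReal (H f x y) ∂(normalLaw (θ f) r) :=
    (hH f).ennreal_ofReal.lintegral_prod_right'
  have hRf (f : ι) : klRisk r (θ f) p ≤ R :=
    le_iSup₂ (f := fun θ (_ : θ ∈ Θ) => klRisk r θ p) (θ f) (hθ f)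
  have hone (f : ι) : ENNReal.ofReal (K + 1)
      ≤ R + ∫⁻ x, ∫⁻ y, W f x y ∂volume ∂(normalLaw (θ f) 1) + E := by
    calc ENNReal.ofReal (K + 1)
        = ∫⁻ _, ENNReal.ofReal (K + 1) ∂(normalLaw (θ f) 1) := by simp
      _ ≤ ∫⁻ x, (klLoss r (θ f) p x + (∫⁻ y, W f x y)
            + ∫⁻ y, ENNReal.ofReal (H f x y) ∂(normalLaw (θ f) r)) ∂(normalLaw (θ f) 1) := by
          refine lintegral_mono fun x => ?_
          refine (ENNReal.ofReal_le_ofReal (add_le_add_left (hK f) 1)).trans ?_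
          exact ofReal_le_klLoss_add r (θ f) p x ((hH f).comp measurable_prodMk_left) (hH0 f x)
      _ = klRisk r (θ f) p + ∫⁻ x, ∫⁻ y, W f x y ∂volume ∂(normalLaw (θ f) 1)
            + ∫⁻ x, ∫⁻ y, ENNReal.ofReal (H f x y) ∂(normalLaw (θ f) r)
              ∂(normalLaw (θ f) 1) := by
          rw [lintegral_add_right _ (hHi f),
            lintegral_add_right _ (hWi f), klRisk]
      _ ≤ _ := add_le_add (add_le_add (hRf f) le_rfl) (hE f)
  have htotal : ∑ f, ∫⁻ x, ∫⁻ y, W f x y ∂volume ∂(normalLaw (θ f) 1) ≤ Fintype.card ι := by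
    have hlm (f : ι) : Measurable fun x => ENNReal.ofReal (Real.exp (logLik (θ f) x)) :=
      (measurable_logLik (θ f)).exp.ennreal_ofReal
    -- Moving every `x`-integral to the common law `N(0, I)` allows the sum over `f` to be taken
    -- pointwise in `(x, y)`, where `hsum` applies.
    have h1 (f : ι) : ∫⁻ x, ∫⁻ y, W f x y ∂volume ∂(normalLaw (θ f) 1)
        = ∫⁻ x, ∫⁻ y, ENNReal.ofReal (Real.exp (logLik (θ f) x)) * W f x y ∂volume
          ∂(normalLaw 0 1) := by
      rw [normalLaw_one_eq_withDensity (θ f),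
        lintegral_withDensity_eq_lintegral_mul _ (hlm f) (hWi f)]
      refine lintegral_congr fun x => ?_
      rw [Pi.mul_apply, lintegral_const_mul _ (hWx f x)]
    have hm (f : ι) : Measurable fun x => ∫⁻ y,
        ENNReal.ofReal (Real.exp (logLik (θ f) x)) * W f x y :=
      (((hlm f).comp measurable_fst).mul (hWm f)).lintegral_prod_right'
    simp_rw [h1]
    rw [← lintegral_finsetSum _ fun f _ => hm f]
    calc _ ≤ ∫⁻ x, ∫⁻ y, (Fintype.card ι : ℝ≥0∞) * p.density x y ∂volume ∂(normalLaw 0 1) := by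
          refine lintegral_mono fun x => ?_
          rw [← lintegral_finsetSum _ fun f _ => (hWx f x).const_mul _]
          refine lintegral_mono fun y => ?_
          have h2 (f : ι) : ENNReal.ofReal (Real.exp (logLik (θ f) x)) * W f x y
              = p.density x y
                * ENNReal.ofReal (Real.exp (logLik (θ f) x + (logLik (θ f) y / r - H f x y))) := by
            rw [hW, Real.exp_add, ENNReal.ofReal_mul (Real.exp_pos _).le]
            ring
          simp_rw [h2]
          rw [← Finset.mul_sum, mul_comm, ← ENNReal.ofReal_sum_of_nonneg
            fun f _ => (Real.exp_pos _).le, ← ENNReal.ofReal_natCast]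
          gcongr
          exact hsum x y
      _ = Fintype.card ι := by
          have (x : Fin n → ℝ) : ∫⁻ y, (Fintype.card ι : ℝ≥0∞) * p.density x y
              = Fintype.card ι := by
            have hd : Measurable (p.density x) :=
              p.measurable_density.comp measurable_prodMk_left
            rw [lintegral_const_mul _ hd, p.lintegral_density, mul_one]
          simp_rw [this]
          simp
  have hcard : (Fintype.card ι : ℝ≥0∞) ≠ 0 := Nat.cast_ne_zero.2 Fintype.card_ne_zero
  have hall : (Fintype.card ι : ℝ≥0∞) * ENNReal.ofReal (K + 1)
      ≤ Fintype.card ι * (R + 1 + E) := by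
    calc (Fintype.card ι : ℝ≥0∞) * ENNReal.ofReal (K + 1)
        = ∑ _f : ι, ENNReal.ofReal (K + 1) := by simp
      _ ≤ ∑ f, (R + ∫⁻ x, ∫⁻ y, W f x y ∂volume ∂(normalLaw (θ f) 1) + E) :=
          Finset.sum_le_sum fun f _ => hone f
      _ ≤ Fintype.card ι * R + Fintype.card ι + Fintype.card ι * E := by
          rw [Finset.sum_add_distrib, Finset.sum_add_distrib]
          simp only [Finset.sum_const, Finset.card_univ, nsmul_eq_mul]
          gcongr
      _ = _ := by ring
  rw [ENNReal.mul_le_mul_iff_right hcard (ENNReal.natCast_ne_top _),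
    ENNReal.ofReal_add hK0 zero_le_one, ENNReal.ofReal_one, add_right_comm] at hall
  exact (ENNReal.add_le_add_iff_right ENNReal.one_ne_top).1 hall

/-! ### The block prior -/

theorem lintegral_exp_gaussianReal (w : ℝ≥0) (a : ℝ) :
    ∫⁻ x, ENNReal.ofReal (Real.exp (a * x - w * a ^ 2 / 2)) ∂(gaussianReal 0 w) = 1 := by
  have hi : Integrable (fun x => Real.exp (a * x)) (gaussianReal 0 w) :=
    integrable_exp_mul_gaussianReal a
  have hm : ∫ x, Real.exp (a * x) ∂(gaussianReal 0 w) = Real.exp (w * a ^ 2 / 2) := by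
    have := congrFun (mgf_id_gaussianReal (μ := 0) (v := w)) a
    simpa [mgf] using this
  simp_rw [Real.exp_sub]
  rw [← ofReal_integral_eq_lintegral_ofReal (hi.div_const _)
    (ae_of_all _ fun x => (div_pos (Real.exp_pos _) (Real.exp_pos _)).le),
    integral_div, hm, div_self (Real.exp_pos _).ne', ENNReal.ofReal_one]

theorem lintegral_prod_normalLaw_eval {n : ℕ} (θ : Fin n → ℝ) (v w : ℝ≥0) (i : Fin n)
    {g k : ℝ → ℝ≥0∞} (hg : Measurable g) (hk : Measurable k) :
    ∫⁻ z, g (z.1 i) * k (z.2 i) ∂((normalLaw θ v).prod (normalLaw θ w))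
      = (∫⁻ x, g x ∂(gaussianReal (θ i) v)) * ∫⁻ y, k y ∂(gaussianReal (θ i) w) := by
  rw [← lintegral_normalLaw_eval θ v i hg, ← lintegral_normalLaw_eval θ w i hk]
  exact lintegral_prod_mul (f := fun x : Fin n → ℝ => g (x i)) (g := fun y : Fin n → ℝ => k (y i))
    (Measurable.aemeasurable (by fun_prop)) (Measurable.aemeasurable (by fun_prop))

theorem sum_ite_exists_eq {α β : Type*} [Fintype α] [Fintype β] [DecidableEq β] {g : α → β}
    (hg : Function.Injective g) (F : β → ℝ) :
    ∑ i, (if ∃ a, g a = i then F i else 0) = ∑ a, F (g a) := by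
  classical
  rw [← Finset.sum_filter, ← Finset.sum_image (s := Finset.univ) (f := F) hg.injOn]
  congr 1
  ext i
  simp

section block

variable {n s m : ℕ}

/-- The vector with the value `τ` at the coordinate chosen by `f` in each of `s` blocks of size
`m`, the `j`-th coordinate of the `b`-th block being `e (b, j)`. -/
noncomputable def blockVec (e : Fin s × Fin m → Fin n) (τ : ℝ) (f : Fin s → Fin m) : Fin n → ℝ :=
  fun i => if ∃ b, e (b, f b) = i then τ else 0

variable {e : Fin s × Fin m → Fin n} {τ : ℝ}

theorem injective_choice (he : Function.Injective e) (f : Fin s → Fin m) :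
    Function.Injective fun b => e (b, f b) :=
  fun _ _ h => congrArg Prod.fst (he h)

theorem sum_blockVec (he : Function.Injective e) (f : Fin s → Fin m) {F : ℝ → Fin n → ℝ}
    (hF : ∀ i, F 0 i = 0) : ∑ i, F (blockVec e τ f i) i = ∑ b, F τ (e (b, f b)) := by
  rw [← sum_ite_exists_eq (injective_choice he f) (F τ)]
  refine Finset.sum_congr rfl fun i _ => ?_
  unfold blockVec
  split_ifs
  · rfl
  · exact hF i

theorem logLik_blockVec (he : Function.Injective e) (f : Fin s → Fin m) (x : Fin n → ℝ) :
    logLik (blockVec e τ f) x = ∑ b, (τ * x (e (b, f b)) - τ ^ 2 / 2) :=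
  sum_blockVec he f (F := fun a i => a * x i - a ^ 2 / 2) (by simp)

theorem blockVec_chosen (f : Fin s → Fin m) (b : Fin s) :
    blockVec e τ f (e (b, f b)) = τ :=
  if_pos ⟨b, rfl⟩

theorem blockVec_not_chosen (he : Function.Injective e) {f : Fin s → Fin m} {b : Fin s}
    {j : Fin m} (hj : j ≠ f b) : blockVec e τ f (e (b, j)) = 0 := by
  refine if_neg ?_
  rintro ⟨b', hb'⟩
  have h := he hb'
  simp only [Prod.mk.injEq] at h
  obtain ⟨rfl, h⟩ := h
  exact hj h.symm

theorem blockVec_mem (hτ : 0 ≤ τ) (f : Fin s → Fin m) :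
    blockVec e τ f ∈ boundedSparseSet n s τ := by
  constructor
  · have hsub : (Finset.univ.filter fun i => blockVec e τ f i ≠ 0)
        ⊆ Finset.univ.image fun b => e (b, f b) := by
      intro i hi
      by_contra h
      refine (Finset.mem_filter.1 hi).2 (if_neg ?_)
      simpa using h
    calc hammingNorm (blockVec e τ f) ≤ (Finset.univ.image fun b => e (b, f b)).card :=
          Finset.card_le_card hsub
      _ ≤ (Finset.univ : Finset (Fin s)).card := Finset.card_image_le
      _ = s := by simp
  · intro i
    unfold blockVec
    split_ifs
    · exact (abs_of_nonneg hτ).le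
    · simpa using hτ

/-- The exponent of the likelihood ratio of `(X, Y)` contributed by the `j`-th coordinate of
block `b`. -/
noncomputable def blockExponent (r : ℝ≥0) (e : Fin s × Fin m → Fin n) (τ : ℝ)
    (x y : Fin n → ℝ) (b : Fin s) (j : Fin m) : ℝ :=
  (τ * x (e (b, j)) - τ ^ 2 / 2) + (τ * y (e (b, j)) - τ ^ 2 / 2) / r

/-- A bound for the logarithm of the likelihood ratio of the marginal law of a block under the
block prior, when the coordinate `j` is the nonzero one. -/
noncomputable def blockBound (r : ℝ≥0) (e : Fin s × Fin m → Fin n) (τ : ℝ)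
    (x y : Fin n → ℝ) (b : Fin s) (j : Fin m) : ℝ :=
  τ / 2 + τ * (x (e (b, j)) - τ) ^ 2 + τ / r ^ 2 * (y (e (b, j)) - τ) ^ 2
    + ∑ k ∈ Finset.univ.erase j, (m : ℝ)⁻¹ * Real.exp (blockExponent r e τ x y b k)

theorem blockBound_nonneg (hτ : 0 ≤ τ) (r : ℝ≥0) (x y : Fin n → ℝ) (b : Fin s) (j : Fin m) :
    0 ≤ blockBound r e τ x y b j := by
  unfold blockBound; positivity

theorem measurable_blockExponent (r : ℝ≥0) (b : Fin s) (j : Fin m) :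
    Measurable fun z : (Fin n → ℝ) × (Fin n → ℝ) => blockExponent r e τ z.1 z.2 b j := by
  unfold blockExponent; fun_prop

theorem measurable_blockBound (r : ℝ≥0) (b : Fin s) (j : Fin m) :
    Measurable fun z : (Fin n → ℝ) × (Fin n → ℝ) => blockBound r e τ z.1 z.2 b j := by
  have h (k : Fin m) := measurable_blockExponent (e := e) (τ := τ) r b k
  unfold blockBound
  fun_prop

/-- The calibration of `τ` makes the exponent at `j` equal to `log m` plus `τ` times centred noise
when `j` carries the spike. The other coordinates enter through `e^V + B ≤ e^V (1 + B) ≤ e^{V + B}`.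
-/
theorem sum_exp_blockExponent_le {r : ℝ≥0} (hr : 0 < r) (hm : 0 < m) (hτ : 0 ≤ τ)
    (hτm : τ ^ 2 / 2 * (1 + 1 / r) = Real.log m) (x y : Fin n → ℝ) (b : Fin s) (j : Fin m) :
    ∑ k, Real.exp (blockExponent r e τ x y b k) ≤ m * Real.exp (blockBound r e τ x y b j) := by
  have hr' : (0 : ℝ) < r := hr
  have hm' : (0 : ℝ) < m := Nat.cast_pos.2 hm
  set V := τ / 2 + τ * (x (e (b, j)) - τ) ^ 2 + τ / r ^ 2 * (y (e (b, j)) - τ) ^ 2 with hV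
  set B := ∑ k ∈ Finset.univ.erase j, (m : ℝ)⁻¹ * Real.exp (blockExponent r e τ x y b k) with hB
  have hV0 : 0 ≤ V := by positivity
  have hB0 : 0 ≤ B := by positivity
  have hbound : blockBound r e τ x y b j = V + B := rfl
  have hU : blockExponent r e τ x y b j ≤ Real.log m + V := by
    have h1 : blockExponent r e τ x y b j
        = Real.log m + τ * ((x (e (b, j)) - τ) + (y (e (b, j)) - τ) / r) := by
      rw [← hτm, blockExponent]; field_simp; ring
    have h2 : V = τ * (1 / 2 + (x (e (b, j)) - τ) ^ 2 + ((y (e (b, j)) - τ) / r) ^ 2) := by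
      rw [hV]; field_simp
    rw [h1, h2]
    refine add_le_add le_rfl (mul_le_mul_of_nonneg_left ?_ hτ)
    -- `a ≤ a² + 1 / 4` for each of the two noise terms, whence `τ / 2` in `blockBound`.
    nlinarith [sq_nonneg (x (e (b, j)) - τ - 1 / 2), sq_nonneg ((y (e (b, j)) - τ) / r - 1 / 2)]
  have hsplit : ∑ k, Real.exp (blockExponent r e τ x y b k)
      = Real.exp (blockExponent r e τ x y b j) + m * B := by
    rw [← Finset.add_sum_erase _ _ (Finset.mem_univ j), hB, ← Finset.mul_sum, ← mul_assoc,
      mul_inv_cancel₀ hm'.ne', one_mul]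
  rw [hsplit, hbound]
  calc _ ≤ m * Real.exp V + m * B := by
        gcongr
        refine (Real.exp_le_exp.2 hU).trans_eq ?_
        rw [Real.exp_add, Real.exp_log hm']
    _ = m * (Real.exp V + B) := by ring
    _ ≤ m * (Real.exp V * (B + 1)) := by
        have : B ≤ Real.exp V * B := le_mul_of_one_le_left hB0 (Real.one_le_exp hV0)
        gcongr
        linarith
    _ ≤ m * Real.exp (V + B) := by
        rw [Real.exp_add V B]
        exact mul_le_mul_of_nonneg_left
          (mul_le_mul_of_nonneg_left (Real.add_one_le_exp B) (Real.exp_pos V).le) hm'.le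

/-- `e^{-H}` is at most `m ^ s / P` with `P` independent of `f`, and by distributivity the products
of chosen exponentials sum over `f` to exactly `P`. -/
theorem sum_exp_block_le {r : ℝ≥0} (hr : 0 < r) (hm : 0 < m) (he : Function.Injective e)
    (hτ : 0 ≤ τ) (hτm : τ ^ 2 / 2 * (1 + 1 / r) = Real.log m) (x y : Fin n → ℝ) :
    ∑ f : Fin s → Fin m, Real.exp (logLik (blockVec e τ f) x
        + (logLik (blockVec e τ f) y / r - ∑ b, blockBound r e τ x y b (f b)))
      ≤ Fintype.card (Fin s → Fin m) := by
  have : Nonempty (Fin m) := ⟨⟨0, hm⟩⟩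
  set P := ∏ b : Fin s, ∑ k, Real.exp (blockExponent r e τ x y b k) with hP
  have hP0 : 0 < P := Finset.prod_pos fun b _ =>
    Finset.sum_pos (fun k _ => Real.exp_pos _) Finset.univ_nonempty
  have hterm (f : Fin s → Fin m) : Real.exp (logLik (blockVec e τ f) x
        + (logLik (blockVec e τ f) y / r - ∑ b, blockBound r e τ x y b (f b)))
      ≤ (m : ℝ) ^ s / P * ∏ b, Real.exp (blockExponent r e τ x y b (f b)) := by
    have h1 : P ≤ (m : ℝ) ^ s * Real.exp (∑ b, blockBound r e τ x y b (f b)) := by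
      calc P ≤ ∏ b, ((m : ℝ) * Real.exp (blockBound r e τ x y b (f b))) :=
            Finset.prod_le_prod (fun b _ => Finset.sum_nonneg fun k _ => (Real.exp_pos _).le)
              fun b _ => sum_exp_blockExponent_le hr hm hτ hτm x y b (f b)
        _ = _ := by rw [Finset.prod_mul_distrib, Real.exp_sum]; simp
    have h2 : logLik (blockVec e τ f) x
        + (logLik (blockVec e τ f) y / r - ∑ b, blockBound r e τ x y b (f b))
        = (∑ b, blockExponent r e τ x y b (f b)) - ∑ b, blockBound r e τ x y b (f b) := by
      rw [logLik_blockVec he, logLik_blockVec he]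
      simp only [blockExponent]
      rw [Finset.sum_add_distrib, Finset.sum_div]
      ring
    rw [h2, Real.exp_sub, Real.exp_sum, div_mul_eq_mul_div, div_le_div_iff₀ (Real.exp_pos _) hP0,
      mul_comm]
    calc _ ≤ ((m : ℝ) ^ s * Real.exp (∑ b, blockBound r e τ x y b (f b)))
          * ∏ b, Real.exp (blockExponent r e τ x y b (f b)) := by gcongr
      _ = _ := by ring
  calc _ ≤ ∑ f : Fin s → Fin m,
        (m : ℝ) ^ s / P * ∏ b, Real.exp (blockExponent r e τ x y b (f b)) :=
        Finset.sum_le_sum fun f _ => hterm f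
    _ = (m : ℝ) ^ s / P * P := by
        rw [← Finset.mul_sum, hP, Finset.prod_univ_sum, Fintype.piFinset_univ]
    _ = _ := by
        rw [div_mul_cancel₀ _ hP0.ne']
        simp

/-- The quadratic terms have means `τ` and `τ / r`. An unselected coordinate is pure noise, so its
likelihood ratio has mean one and the `m - 1` of them, weighted by `1 / m`, add at most `1`. -/
theorem lintegral_blockBound_le {r : ℝ≥0} (hr : 0 < r) (hm : 0 < m)
    (he : Function.Injective e) (hτ : 0 ≤ τ) (f : Fin s → Fin m) (b : Fin s) :
    ∫⁻ z, ENNReal.ofReal (blockBound r e τ z.1 z.2 b (f b))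
        ∂((normalLaw (blockVec e τ f) 1).prod (normalLaw (blockVec e τ f) r))
      ≤ ENNReal.ofReal (1 + (3 / 2 + 1 / r) * τ) := by
  have hr' : (0 : ℝ) < r := hr
  set θ := blockVec e τ f with hθ
  set i := e (b, f b) with hi
  have hθi : θ i = τ := blockVec_chosen f b
  set g₁ : ℝ → ℝ≥0∞ := fun u => ENNReal.ofReal (τ * (u - τ) ^ 2) with hg₁
  set k₁ : ℝ → ℝ≥0∞ := fun u => ENNReal.ofReal (τ / r ^ 2 * (u - τ) ^ 2) with hk₁
  set g₂ : ℝ → ℝ≥0∞ := fun u => ENNReal.ofReal (Real.exp (τ * u - τ ^ 2 / 2)) with hg₂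
  set k₂ : ℝ → ℝ≥0∞ := fun u => ENNReal.ofReal (Real.exp ((τ * u - τ ^ 2 / 2) / r)) with hk₂
  have hg₁m : Measurable g₁ := by fun_prop
  have hk₁m : Measurable k₁ := by fun_prop
  have hg₂m : Measurable g₂ := by fun_prop
  have hk₂m : Measurable k₂ := by fun_prop
  set μ := (normalLaw θ 1).prod (normalLaw θ r) with hμ
  have hpt (z : (Fin n → ℝ) × (Fin n → ℝ)) :
      ENNReal.ofReal (blockBound r e τ z.1 z.2 b (f b))
        ≤ ENNReal.ofReal (τ / 2) + g₁ (z.1 i) * 1 + 1 * k₁ (z.2 i)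
          + ∑ j ∈ Finset.univ.erase (f b),
            ENNReal.ofReal (m : ℝ)⁻¹ * (g₂ (z.1 (e (b, j))) * k₂ (z.2 (e (b, j)))) := by
    have hsum : ENNReal.ofReal (∑ j ∈ Finset.univ.erase (f b),
          (m : ℝ)⁻¹ * Real.exp (blockExponent r e τ z.1 z.2 b j))
        = ∑ j ∈ Finset.univ.erase (f b),
            ENNReal.ofReal (m : ℝ)⁻¹ * (g₂ (z.1 (e (b, j))) * k₂ (z.2 (e (b, j)))) := by
      rw [ENNReal.ofReal_sum_of_nonneg fun j _ => by positivity]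
      refine Finset.sum_congr rfl fun j _ => ?_
      rw [ENNReal.ofReal_mul (by positivity), blockExponent, Real.exp_add,
        ENNReal.ofReal_mul (Real.exp_pos _).le]
    rw [blockBound, mul_one, one_mul, ← hsum]
    exact ENNReal.ofReal_add_le.trans (add_le_add_left (ENNReal.ofReal_add_le.trans
      (add_le_add_left ENNReal.ofReal_add_le _)) _)
  have hm1 : Measurable fun z : (Fin n → ℝ) × (Fin n → ℝ) => g₁ (z.1 i) * (1 : ℝ≥0∞) := by
    fun_prop
  have hm2 : Measurable fun z : (Fin n → ℝ) × (Fin n → ℝ) => (1 : ℝ≥0∞) * k₁ (z.2 i) := by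
    fun_prop
  have hm4 : Measurable fun z : (Fin n → ℝ) × (Fin n → ℝ) =>
      ENNReal.ofReal (τ / 2) + g₁ (z.1 i) * (1 : ℝ≥0∞) := measurable_const.add hm1
  have hm5 : Measurable fun z : (Fin n → ℝ) × (Fin n → ℝ) =>
      ENNReal.ofReal (τ / 2) + g₁ (z.1 i) * (1 : ℝ≥0∞) + (1 : ℝ≥0∞) * k₁ (z.2 i) := hm4.add hm2
  have hm3 (j : Fin m) : Measurable fun z : (Fin n → ℝ) × (Fin n → ℝ) =>
      g₂ (z.1 (e (b, j))) * k₂ (z.2 (e (b, j))) := by fun_prop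
  have hI1 : ∫⁻ z, g₁ (z.1 i) * 1 ∂μ ≤ ENNReal.ofReal τ := by
    rw [hμ, lintegral_prod_normalLaw_eval θ 1 r i hg₁m (k := fun _ => 1) measurable_const, hθi]
    have := lintegral_le_of_le_quadratic (θ := τ) (w := 1) (f := fun u => τ * (u - τ) ^ 2)
      le_rfl hτ fun u => by linarith
    simpa using this
  have hI2 : ∫⁻ z, 1 * k₁ (z.2 i) ∂μ ≤ ENNReal.ofReal (τ / r) := by
    rw [hμ, lintegral_prod_normalLaw_eval θ 1 r i (g := fun _ => 1) measurable_const hk₁m, hθi]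
    have h := lintegral_le_of_le_quadratic (θ := τ) (w := r)
      (f := fun u => τ / r ^ 2 * (u - τ) ^ 2) le_rfl (show 0 ≤ τ / (r : ℝ) ^ 2 by positivity)
      fun u => by linarith
    have h' : 0 + τ / (r : ℝ) ^ 2 * r = τ / r := by field_simp; ring
    rw [h'] at h
    simpa using h
  have hI3 (j : Fin m) (hj : j ∈ Finset.univ.erase (f b)) :
      ∫⁻ z, g₂ (z.1 (e (b, j))) * k₂ (z.2 (e (b, j))) ∂μ = 1 := by
    rw [hμ, lintegral_prod_normalLaw_eval θ 1 r _ hg₂m hk₂m, hθ,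
      blockVec_not_chosen he (Finset.ne_of_mem_erase hj)]
    have h1 := lintegral_exp_gaussianReal 1 τ
    have h2 := lintegral_exp_gaussianReal r (τ / r)
    have h3 (u : ℝ) : τ / r * u - r * (τ / r) ^ 2 / 2 = (τ * u - τ ^ 2 / 2) / r := by
      field_simp
    simp only [NNReal.coe_one, one_mul] at h1
    simp_rw [h3] at h2
    rw [h1, h2, one_mul]
  have hI4 : ∑ j ∈ Finset.univ.erase (f b), ENNReal.ofReal (m : ℝ)⁻¹
      * ∫⁻ z, g₂ (z.1 (e (b, j))) * k₂ (z.2 (e (b, j))) ∂μ ≤ 1 := by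
    have hm' : (0 : ℝ) < m := Nat.cast_pos.2 hm
    calc _ = ∑ j ∈ Finset.univ.erase (f b), ENNReal.ofReal (m : ℝ)⁻¹ :=
          Finset.sum_congr rfl fun j hj => by rw [hI3 j hj, mul_one]
      _ ≤ ∑ j : Fin m, ENNReal.ofReal (m : ℝ)⁻¹ :=
          Finset.sum_le_sum_of_subset (Finset.erase_subset _ _)
      _ = 1 := by
          rw [Finset.sum_const, Finset.card_univ, Fintype.card_fin, nsmul_eq_mul,
            ← ENNReal.ofReal_natCast, ← ENNReal.ofReal_mul hm'.le, mul_inv_cancel₀ hm'.ne',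
            ENNReal.ofReal_one]
  calc _ ≤ _ := lintegral_mono hpt
    _ = ENNReal.ofReal (τ / 2) + (∫⁻ z, g₁ (z.1 i) * 1 ∂μ) + (∫⁻ z, 1 * k₁ (z.2 i) ∂μ)
        + ∑ j ∈ Finset.univ.erase (f b), ENNReal.ofReal (m : ℝ)⁻¹
          * ∫⁻ z, g₂ (z.1 (e (b, j))) * k₂ (z.2 (e (b, j))) ∂μ := by
        rw [lintegral_add_left hm5, lintegral_add_left hm4, lintegral_add_left measurable_const,
          lintegral_finsetSum _ fun j _ => (hm3 j).const_mul _]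
        simp_rw [lintegral_const_mul _ (hm3 _)]
        simp
    _ ≤ ENNReal.ofReal (τ / 2) + ENNReal.ofReal τ + ENNReal.ofReal (τ / r) + 1 := by
        gcongr
    _ = _ := by
        rw [← ENNReal.ofReal_one, ← ENNReal.ofReal_add (by positivity) hτ,
          ← ENNReal.ofReal_add (by positivity) (by positivity),
          ← ENNReal.ofReal_add (by positivity) zero_le_one]
        congr 1
        ring

theorem ofReal_le_minimaxRisk_boundedSparseSet {r : ℝ≥0} (hr : 0 < r) (hm : 0 < m)
    (hnm : s * m ≤ n) (hτ : 0 ≤ τ) (hτm : τ ^ 2 / 2 * (1 + 1 / r) = Real.log m) :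
    ENNReal.ofReal (s * (Real.log m / (1 + r))) ≤ minimaxRisk r (boundedSparseSet n s τ)
      + ENNReal.ofReal (s * (1 + (3 / 2 + 1 / r) * τ)) := by
  have hr' : (0 : ℝ) < r := hr
  have hne : Nonempty (Fin m) := ⟨⟨0, hm⟩⟩
  -- The blocks fill the first `s * m` coordinates; the remaining ones stay zero.
  obtain ⟨e, he⟩ : ∃ e : Fin s × Fin m → Fin n, Function.Injective e :=
    ⟨fun p => Fin.castLE hnm (finProdFinEquiv p),
      (Fin.castLE_injective hnm).comp finProdFinEquiv.injective⟩
  have hlog : 0 ≤ Real.log m := Real.log_natCast_nonneg m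
  have hHm (f : Fin s → Fin m) : Measurable fun z : (Fin n → ℝ) × (Fin n → ℝ) =>
      ∑ b, blockBound r e τ z.1 z.2 b (f b) :=
    Finset.measurable_fun_sum _ fun b _ => measurable_blockBound r b (f b)
  refine ofReal_le_minimaxRisk_add (blockVec e τ) (fun f => blockVec_mem hτ f)
    (fun f x y => ∑ b, blockBound r e τ x y b (f b)) hHm
    (fun f x y => Finset.sum_nonneg fun b _ => blockBound_nonneg hτ r x y b (f b))
    (sum_exp_block_le hr hm he hτ hτm) (by positivity) (fun f => le_of_eq ?_) fun f => ?_
  · rw [sum_blockVec he f (F := fun a _ => a ^ 2 / 2) (by simp), ← hτm]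
    simp only [Finset.sum_const, Finset.card_univ, Fintype.card_fin, nsmul_eq_mul]
    field_simp
    ring
  · have hmeas : AEMeasurable (fun z : (Fin n → ℝ) × (Fin n → ℝ) =>
        ENNReal.ofReal (∑ b, blockBound r e τ z.1 z.2 b (f b)))
        ((normalLaw (blockVec e τ f) 1).prod (normalLaw (blockVec e τ f) r)) :=
      (hHm f).ennreal_ofReal.aemeasurable
    rw [← lintegral_prod (fun z : (Fin n → ℝ) × (Fin n → ℝ) =>
        ENNReal.ofReal (∑ b, blockBound r e τ z.1 z.2 b (f b))) hmeas]
    simp_rw [ENNReal.ofReal_sum_of_nonneg fun b _ => blockBound_nonneg hτ r _ _ b (f b)]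
    rw [lintegral_finsetSum _ fun b _ => (measurable_blockBound r b (f b)).ennreal_ofReal]
    refine (Finset.sum_le_sum fun b _ => lintegral_blockBound_le hr hm he hτ f b).trans_eq ?_
    rw [Finset.sum_const, Finset.card_univ, Fintype.card_fin, nsmul_eq_mul,
      ← ENNReal.ofReal_natCast, ← ENNReal.ofReal_mul (Nat.cast_nonneg s)]

end block

/-! ### Asymptotics -/

theorem minimaxRisk_mono {n : ℕ} (r : ℝ≥0) {Θ Θ' : Set (Fin n → ℝ)} (h : Θ ⊆ Θ') :
    minimaxRisk r Θ ≤ minimaxRisk r Θ' :=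
  iInf_mono fun _ => biSup_mono h

theorem boundedSparseSet_mono {n s : ℕ} {t t' : ℝ} (h : t ≤ t') :
    boundedSparseSet n s t ⊆ boundedSparseSet n s t' :=
  fun _ hθ => ⟨hθ.1, fun i => (hθ.2 i).trans h⟩

theorem boundedSparseSet_subset_sparseSet (n s : ℕ) (t : ℝ) :
    boundedSparseSet n s t ⊆ sparseSet n s :=
  fun _ hθ => hθ.1

/-! ### The lower bound in terms of `L = log (n / s)`. -/

section

variable {r : ℝ≥0} {n s : ℕ} {L : ℝ}

theorem lam_eq (hr : 0 < r) (hn : 0 < n) (hs : 0 < s) (hL : L = Real.log (n / s)) :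
    lam r (s / n) = Real.sqrt (2 * (r / (1 + r) * L)) := by
  have hr' : (0 : ℝ) < r := hr
  have hn' : (0 : ℝ) < n := Nat.cast_pos.2 hn
  have hs' : (0 : ℝ) < s := Nat.cast_pos.2 hs
  have hv : oracleVar r = r / (1 + r) := by rw [oracleVar]; field_simp; ring
  rw [lam, Real.log_rpow (by positivity), hL, ← inv_div (s : ℝ) n, Real.log_inv, hv]
  congr 2
  ring

theorem mul_lam_sq_div (hr : 0 < r) (hn : 0 < n) (hs : 0 < s) (hL : L = Real.log (n / s))
    (hL0 : 0 ≤ L) : s * lam r (s / n) ^ 2 / (2 * r) = s * (L / (1 + r)) := by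
  have hr' : (0 : ℝ) < r := hr
  rw [lam_eq hr hn hs hL, Real.sq_sqrt (by positivity)]
  field_simp

/-- Rounding `n / s` down to `m` is harmless: `log m ≤ L` gives `τ ≤ λ ≤ t`, keeping the prior
inside the bounded set, and `n / s ≤ 2 m` costs at most `log 2 < 1` in `log m`. -/
theorem le_minimaxRisk_boundedSparseSet (hr : 0 < r) (hn : 0 < n) (hs : 0 < s)
    (hL : L = Real.log (n / s)) (hL1 : 1 ≤ L) {t : ℝ} (ht : lam r (s / n) ≤ t) :
    ENNReal.ofReal (s * (L / (1 + r) - (5 + 2 / r) * Real.sqrt L))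
      ≤ minimaxRisk r (boundedSparseSet n s t) := by
  have hr' : (0 : ℝ) < r := hr
  have hn' : (0 : ℝ) < n := Nat.cast_pos.2 hn
  have hs' : (0 : ℝ) < s := Nat.cast_pos.2 hs
  have hsL : 1 ≤ Real.sqrt L := Real.one_le_sqrt.2 hL1
  have hns : s ≤ n := by
    by_contra! h
    have h1 : (n : ℝ) / s ≤ 1 := (div_le_one hs').2 (by exact_mod_cast h.le)
    have h2 := Real.log_nonpos (by positivity) h1
    linarith
  have hm : 0 < n / s := Nat.div_pos hns hs
  set m := n / s with hmdef
  have hm' : (0 : ℝ) < m := Nat.cast_pos.2 hm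
  have hnm : s * m ≤ n := Nat.mul_div_le n s
  have hlog : 0 ≤ Real.log m := Real.log_natCast_nonneg m
  have hlogL : Real.log m ≤ L := by
    rw [hL]
    exact Real.log_le_log hm' Nat.cast_div_le
  have hLlog : L - 1 ≤ Real.log m := by
    have h1 : n < 2 * (s * m) := by
      have h2 : n < s * (m + 1) := Nat.lt_mul_div_succ n hs
      have h3 : s * 1 ≤ s * m := Nat.mul_le_mul_left s hm
      linarith
    have h4 : (n : ℝ) / s ≤ 2 * m := by
      rw [div_le_iff₀ hs']
      have : (n : ℝ) ≤ 2 * (s * m) := by exact_mod_cast h1.le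
      linarith
    have h5 := Real.log_le_log (by positivity) h4
    rw [Real.log_mul two_ne_zero hm'.ne', ← hL] at h5
    have := Real.log_two_lt_d9
    linarith
  set τ := Real.sqrt (2 * (r / (1 + r) * Real.log m)) with hτ
  have hτsq : τ ^ 2 = 2 * (r / (1 + r) * Real.log m) := Real.sq_sqrt (by positivity)
  have hτt : τ ≤ t := by
    refine le_trans ?_ ht
    rw [lam_eq hr hn hs hL]
    exact Real.sqrt_le_sqrt (by gcongr)
  have hτL : τ ≤ 2 * Real.sqrt L := by
    have h1 : (r : ℝ) / (1 + r) ≤ 1 := (div_le_one (by positivity)).2 (by linarith)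
    rw [hτ, Real.sqrt_le_left (by positivity), mul_pow, Real.sq_sqrt (by linarith)]
    have h2 : (r : ℝ) / (1 + r) * Real.log m ≤ 1 * L := mul_le_mul h1 hlogL hlog zero_le_one
    linarith
  have hτm : τ ^ 2 / 2 * (1 + 1 / r) = Real.log m := by
    rw [hτsq]; field_simp; ring
  have key := ofReal_le_minimaxRisk_boundedSparseSet hr hm hnm (Real.sqrt_nonneg _) hτm
  refine le_trans ?_ (minimaxRisk_mono r (boundedSparseSet_mono (s := s) hτt))
  refine le_trans ?_ (tsub_le_iff_right.2 key)
  rw [← ENNReal.ofReal_sub _ (by positivity), ← mul_sub]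
  refine ENNReal.ofReal_le_ofReal (mul_le_mul_of_nonneg_left ?_ hs'.le)
  have h1 : (L - 1) / (1 + r) ≤ Real.log m / (1 + r) := by gcongr
  have h2 : 1 / (1 + (r : ℝ)) ≤ 1 := (div_le_one (by positivity)).2 (by linarith)
  have h3 : (3 / 2 + 1 / (r : ℝ)) * τ ≤ (3 / 2 + 1 / (r : ℝ)) * (2 * Real.sqrt L) := by gcongr
  -- The extra `2 √L` pays for the constant `1` of the block bound and for the rounding loss `1 / (1
  -- + r)`.
  have h4 : (3 / 2 + 1 / (r : ℝ)) * (2 * Real.sqrt L) + 2 * Real.sqrt L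
      = (5 + 2 / r) * Real.sqrt L := by ring
  rw [sub_div] at h1
  linarith

end

theorem tendsto_div_of_bounds {R : ℕ → ℝ≥0∞} {d ε δ : ℕ → ℝ} (hd : ∀ᶠ n in atTop, 0 < d n)
    (hε : Tendsto ε atTop (𝓝 0)) (hδ : Tendsto δ atTop (𝓝 0))
    (hl : ∀ᶠ n in atTop, ENNReal.ofReal (d n * (1 - ε n)) ≤ R n)
    (hu : ∀ᶠ n in atTop, R n ≤ ENNReal.ofReal (d n * (1 + δ n))) :
    Tendsto (fun n => R n / ENNReal.ofReal (d n)) atTop (𝓝 1) := by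
  have h1 : Tendsto (fun n => ENNReal.ofReal (1 - ε n)) atTop (𝓝 1) := by
    have := ENNReal.tendsto_ofReal (hε.const_sub 1)
    simpa using this
  have h2 : Tendsto (fun n => ENNReal.ofReal (1 + δ n)) atTop (𝓝 1) := by
    have := ENNReal.tendsto_ofReal (hδ.const_add 1)
    simpa using this
  refine tendsto_of_tendsto_of_tendsto_of_le_of_le' h1 h2 ?_ ?_
  · filter_upwards [hd, hl] with n hdn h
    rw [ENNReal.le_div_iff_mul_le (Or.inl (ENNReal.ofReal_pos.2 hdn).ne')
      (Or.inl ENNReal.ofReal_ne_top), mul_comm, ← ENNReal.ofReal_mul hdn.le]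
    exact h
  · filter_upwards [hd, hu] with n hdn h
    rw [ENNReal.div_le_iff (ENNReal.ofReal_pos.2 hdn).ne' ENNReal.ofReal_ne_top, mul_comm,
      ← ENNReal.ofReal_mul hdn.le]
    exact h

theorem AsympEquiv.symm_of_ofReal {R : ℕ → ℝ≥0∞} {d : ℕ → ℝ} (hd : ∀ᶠ n in atTop, 0 < d n)
    (h : AsympEquiv R fun n => ENNReal.ofReal (d n)) :
    AsympEquiv (fun n => ENNReal.ofReal (d n)) R := by
  have h1 : Tendsto (fun n => (R n / ENNReal.ofReal (d n))⁻¹) atTop (𝓝 1) := by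
    simpa using tendsto_inv_iff.2 h
  refine h1.congr' ?_
  filter_upwards [hd] with n hdn
  exact ENNReal.inv_div (Or.inl ENNReal.ofReal_ne_top) (Or.inl (ENNReal.ofReal_pos.2 hdn).ne')

theorem asympEquiv_minimaxRisk {r : ℝ≥0} (hr : 0 < r) {s : ℕ → ℕ} {t : ℕ → ℝ}
    (hs : ∀ᶠ n in atTop, 1 ≤ s n)
    (hη : Tendsto (fun n => (s n : ℝ) / (n : ℝ)) atTop (𝓝 0))
    (ht : ∀ᶠ n in atTop, lam r ((s n : ℝ) / (n : ℝ)) < t n) :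
    AsympEquiv (fun n => minimaxRisk r (boundedSparseSet n (s n) (t n)))
        (fun n => ENNReal.ofReal (s n * lam r ((s n : ℝ) / (n : ℝ)) ^ 2 / (2 * r))) ∧
      AsympEquiv (fun n => ENNReal.ofReal (s n * lam r ((s n : ℝ) / (n : ℝ)) ^ 2 / (2 * r)))
        (fun n => minimaxRisk r (sparseSet n (s n))) := by
  have hr' : (0 : ℝ) < r := hr
  set L : ℕ → ℝ := fun n => Real.log (n / s n) with hLdef
  have hLtop : Tendsto L atTop atTop := by
    -- Convergence from the right, by `s n ≥ 1`, is what makes `log (1 / η)` tend to infinity.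
    have h1 : Tendsto (fun n => (s n : ℝ) / (n : ℝ)) atTop (𝓝[>] 0) := by
      refine tendsto_nhdsWithin_iff.2 ⟨hη, ?_⟩
      filter_upwards [hs, eventually_gt_atTop 0] with n h hn
      have hn' : (0 : ℝ) < n := Nat.cast_pos.2 hn
      have hs' : (0 : ℝ) < s n := Nat.cast_pos.2 h
      exact div_pos hs' hn'
    have h2 := Real.tendsto_log_atTop.comp (tendsto_inv_nhdsGT_zero.comp h1)
    refine h2.congr fun n => ?_
    simp [hLdef]
  have hsqrt (C : ℝ) : Tendsto (fun n => C * (1 + r) / Real.sqrt (L n)) atTop (𝓝 0) :=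
    (Real.tendsto_sqrt_atTop.comp hLtop).const_div_atTop _
  have hL2 : ∀ᶠ n in atTop, 2 ≤ L n := hLtop.eventually_ge_atTop 2
  have hD : ∀ᶠ n in atTop, s n * lam r ((s n : ℝ) / (n : ℝ)) ^ 2 / (2 * r)
      = s n * (L n / (1 + r)) := by
    filter_upwards [hs, eventually_gt_atTop 0, hL2] with n h hn hL
    exact mul_lam_sq_div hr hn h rfl (by linarith)
  have hD0 : ∀ᶠ n in atTop, 0 < s n * lam r ((s n : ℝ) / (n : ℝ)) ^ 2 / (2 * r) := by
    filter_upwards [hD, hs, hL2] with n h hsn hL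
    have hs' : (0 : ℝ) < s n := Nat.cast_pos.2 hsn
    rw [h]
    positivity
  -- Turns the additive error `C √L` into a relative error of order `1 / √L`.
  have hrw (S l C : ℝ) (hl : 2 ≤ l) :
      S * (l / (1 + r)) * (1 + C * (1 + r) / Real.sqrt l)
        = S * (l / (1 + r) + C * Real.sqrt l) := by
    have h1 : 0 < Real.sqrt l := Real.sqrt_pos.2 (by linarith)
    have h2 : Real.sqrt l * Real.sqrt l = l := Real.mul_self_sqrt (by linarith)
    set σ := Real.sqrt l
    rw [← h2]
    field_simp
  have hlower : ∀ᶠ n in atTop, ENNReal.ofReal (s n * lam r ((s n : ℝ) / (n : ℝ)) ^ 2 / (2 * r)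
      * (1 - (5 + 2 / r) * (1 + r) / Real.sqrt (L n)))
      ≤ minimaxRisk r (boundedSparseSet n (s n) (t n)) := by
    filter_upwards [hD, hs, eventually_gt_atTop 0, hL2, ht] with n h hsn hn hL htn
    have h1 := hrw (s n) (L n) (-(5 + 2 / r)) hL
    rw [neg_mul, neg_div, ← sub_eq_add_neg, neg_mul, ← sub_eq_add_neg] at h1
    rw [h, h1]
    exact le_minimaxRisk_boundedSparseSet hr hn hsn rfl (by linarith) htn.le
  have hupper : ∀ᶠ n in atTop, minimaxRisk r (sparseSet n (s n))
      ≤ ENNReal.ofReal (s n * lam r ((s n : ℝ) / (n : ℝ)) ^ 2 / (2 * r)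
      * (1 + (9 + r + 1 / r) * (1 + r) / Real.sqrt (L n))) := by
    filter_upwards [hD, hs, eventually_gt_atTop 0, hL2] with n h hsn hn hL
    rw [h, hrw _ _ _ hL]
    exact minimaxRisk_sparseSet_le hr hn hsn rfl hL
  have hmono (n : ℕ) : minimaxRisk r (boundedSparseSet n (s n) (t n))
      ≤ minimaxRisk r (sparseSet n (s n)) :=
    minimaxRisk_mono r (boundedSparseSet_subset_sparseSet _ _ _)
  refine ⟨tendsto_div_of_bounds hD0 (hsqrt _) (hsqrt _) hlower
    (hupper.mono fun n h => (hmono n).trans h), AsympEquiv.symm_of_ofReal hD0 ?_⟩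
  exact tendsto_div_of_bounds hD0 (hsqrt _) (hsqrt _)
    (hlower.mono fun n h => h.trans (hmono n)) hupper

end SparsePrediction

theorem lemma1p2 (r : ℝ≥0) (hr : 0 < r) :
    (∀ (n s : ℕ) (t : ℝ),
      SparsePrediction.minimaxRisk r (SparsePrediction.boundedSparseSet n s t)
        ≤ ENNReal.ofReal (s * t ^ 2 / (2 * r))) ∧
    (∀ (s : ℕ → ℕ) (t : ℕ → ℝ),
      (∀ᶠ n in atTop, 1 ≤ s n) →
      Tendsto (fun n => (s n : ℝ) / (n : ℝ)) atTop (𝓝 0) →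
      (∀ᶠ n in atTop, SparsePrediction.lam r ((s n : ℝ) / (n : ℝ)) < t n) →
      SparsePrediction.AsympEquiv
        (fun n => SparsePrediction.minimaxRisk r
          (SparsePrediction.boundedSparseSet n (s n) (t n)))
        (fun n => ENNReal.ofReal
          (s n * SparsePrediction.lam r ((s n : ℝ) / (n : ℝ)) ^ 2 / (2 * r))) ∧
      SparsePrediction.AsympEquiv
        (fun n => ENNReal.ofReal
          (s n * SparsePrediction.lam r ((s n : ℝ) / (n : ℝ)) ^ 2 / (2 * r)))
        (fun n => SparsePrediction.minimaxRisk r (SparsePrediction.sparseSet n (s n)))) :=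
  ⟨SparsePrediction.minimaxRisk_boundedSparseSet_le hr,
    fun _ _ hs hη ht => SparsePrediction.asympEquiv_minimaxRisk hr hs hη ht⟩
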